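/- For each $N\ge 1$ let $x^{(N)}_{ij}$, $1\le i,j\le N$, be independent complex random variables (whose laws, and whose underlying probability space, may depend on $N$) with $$\mathbb{E}\,x^{(N)}_{ij}=0,\qquad \mathbb{E}|x^{(N)}_{ij}|^2=1,\qquad \mathbb{E}|x^{(N)}_{ij}|^4\le B$$ for all $N,i,j$, with some $B<\infty$ independent of $N,i,j$, and assume that for every $\alpha>0$ $$L_N(\alpha)=N^{-2}\sum_{1\le i,j\le N}\mathbb{E}\Big[|x^{(N)}_{ij}|^4\,\mathbb{I}\{|x^{(N)}_{ij}|>\alpha\sqrt N\}\Big]\to 0\qquad (N\to\infty).$$ Let $\mathbf{X}=(N^{-1/2}x^{(N)}_{ij})_{1\le i,j\le N}$, let $m\ge 1$ be an integer, let $\lambda_1,\dots,\lambda_N$ be the eigenvalues, counted with multiplicity, of the Hermitian matrix $\mathbf{X}^m(\mathbf{X}^*)^m$, and let $F^{(m)}_N(t)=N^{-1}\sum_{k=1}^N\mathbb{I}\{\lambda_k\le t\}$ be their empirical distribution function. Then for every $t\in\mathbb{R}$ the limit $G^{(m)}(t)=\lim_{N\to\infty}\mathbb{E}F^{(m)}_N(t)$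 exists. The function $G^{(m)}$ depends only on $m$, it is a probability distribution function (non-decreasing, right-continuous, with limits $0$ at $-\infty$ and $1$ at $+\infty$), and all its moments are finite and equal to the Fuss--Catalan numbers: for every integer $p\ge 0$, $$\int_{\mathbb{R}}t^p\,dG^{(m)}(t)=\frac{1}{mp+1}\binom{mp+p}{p}.$$ -/

import Mathlib

open MeasureTheory ProbabilityTheory Filter Topology

/-- The normalised `N × N` random matrix `X = (N^{-1/2} x_{ij})`, at the sample point `ω`. -/
noncomputable def normalizedMatrix {Ω : Type*} {N : ℕ} (x : Fin N → Fin N → Ω → ℂ) (ω : Ω) :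
    Matrix (Fin N) (Fin N) ℂ :=
  Matrix.of fun i j => (((Real.sqrt N)⁻¹ : ℝ) : ℂ) * x i j ω

/-- The matrix `X^m (X^*)^m`. -/
def powerMatrix {N : ℕ} (m : ℕ) (X : Matrix (Fin N) (Fin N) ℂ) : Matrix (Fin N) (Fin N) ℂ :=
  X ^ m * X.conjTranspose ^ m

theorem powerMatrix_isHermitian {N : ℕ} (m : ℕ) (X : Matrix (Fin N) (Fin N) ℂ) :
    (powerMatrix m X).IsHermitian := by
  unfold powerMatrix
  rw [← Matrix.conjTranspose_pow]
  exact Matrix.isHermitian_mul_conjTranspose_self _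

/-- The empirical spectral distribution function of a Hermitian `N × N` matrix:
the proportion of eigenvalues (counted with multiplicity) that are at most `t`. -/
noncomputable def empiricalSpectralDistribution {N : ℕ} {A : Matrix (Fin N) (Fin N) ℂ}
    (hA : A.IsHermitian) (t : ℝ) : ℝ :=
  (N : ℝ)⁻¹ * ∑ k : Fin N, Set.indicator {s : ℝ | s ≤ t} (fun _ => (1 : ℝ)) (hA.eigenvalues k)

/-- The expectation `E F_N^{(m)}(t)` of the empirical spectral distribution function of
`X^m (X^*)^m`, where `X = (N^{-1/2} x_{ij})`. -/
noncomputable def expectedESD {Ω : Type*} [MeasurableSpace Ω] (P : Measure Ω) {N : ℕ}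
    (x : Fin N → Fin N → Ω → ℂ) (m : ℕ) (t : ℝ) : ℝ :=
  ∫ ω, empiricalSpectralDistribution (powerMatrix_isHermitian m (normalizedMatrix x ω)) t ∂P

/-- `L_N(α) = N^{-2} ∑_{i,j} E |x_{ij}|^4 1{|x_{ij}| > α √N}`. -/
noncomputable def lindebergFourth {Ω : Type*} [MeasurableSpace Ω] (P : Measure Ω) {N : ℕ}
    (x : Fin N → Fin N → Ω → ℂ) (α : ℝ) : ℝ :=
  ((N : ℝ) ^ 2)⁻¹ * ∑ i : Fin N, ∑ j : Fin N,
    ∫ ω, Set.indicator {ω' | α * Real.sqrt N < ‖x i j ω'‖} (fun ω' => ‖x i j ω'‖ ^ 4) ω ∂P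

/-- The assumptions on the entries. For each `N` the `x N i j` are independent complex random
variables on a probability space that may vary with `N`, centred, of unit variance, with fourth
moments bounded uniformly in `i`, `j`, `N`, and satisfying the Lindeberg-type condition. -/
structure EntryConditions {Ω : ℕ → Type*} [∀ N, MeasurableSpace (Ω N)]
    (P : ∀ N, Measure (Ω N)) (x : ∀ N, Fin N → Fin N → Ω N → ℂ) : Prop where
  measurable : ∀ N i j, Measurable (x N i j)
  indep : ∀ N, iIndepFun (fun ij : Fin N × Fin N => x N ij.1 ij.2) (P N)
  mean : ∀ N i j, ∫ ω, x N i j ω ∂(P N) = 0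
  variance : ∀ N i j, ∫ ω, ‖x N i j ω‖ ^ 2 ∂(P N) = 1
  fourth : ∃ B : ℝ, ∀ N i j,
    Integrable (fun ω => ‖x N i j ω‖ ^ 4) (P N) ∧ ∫ ω, ‖x N i j ω‖ ^ 4 ∂(P N) ≤ B
  lindeberg : ∀ α : ℝ, 0 < α → Tendsto (fun N => lindebergFourth (P N) (x N) α) atTop (𝓝 0)

/-! The proof is the method of moments. The `p`-th moment of the expected spectral distribution is
`N⁻¹ E tr (X^m (X*)^m)^p`, a normalised trace of the word `(a^m b^m)^p` in `X` and `X*`. Expanding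
it gives a sum over closed walks on `N` vertices whose steps are matrix positions marked with the
letter that reads them. By independence a walk contributes a product of entry moments
(`integral_trace_wordMatrix`).

After truncation each distinct position contributes at most `1/N`, while a walk with `v` vertices
can be labelled in at most `N^v` ways. A walk has at most one vertex more than it has distinct
edges, so the surviving walks have exactly one more and cross every edge exactly twice
(`card_le_or_exists_count_ne`, `norm_pathMoment_sub_le`). Such a walk runs depth-first around a
tree, crosses each edge once with each letter, and contributes a product of variances. Its shape is
a noncrossing pairing of opposite letters, counted by `stackCount`. No other feature of the entry
laws enters, hence universality.

For the block word, completions of a partially read word have generating function `z^t F^r` with `F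
= 1 + z F^(m+1)` (`stackCount_blockWord`), and the closed form of the coefficients gives the
Fuss–Catalan numbers (`raney_closed_form`).

A law with these moments is exhibited as a scaled product of independent beta variables
(`exists_fussCatalan_law`). Its compact support lets moments control integrals of bounded continuous
functions, and the absence of atoms gives convergence at every `t`
(`tendsto_measureReal_Iic_of_tendsto_moments`). Truncation at `α_N √N`, with `α_N → 0` slowly,
changes the expected distribution function by at most `L_N(α_N) / α_N^4`
(`abs_expectedESD_sub_truncate_le`). -/

/-! ### Stack words and Fuss–Catalan numbers -/

/-- The number of ways to read the word `w`, starting from the stack `s`, where each letter is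
either pushed or cancels an opposite letter at the top of the stack, so that the stack is empty at
the end. With `s = []` this counts the noncrossing pairings of `w` matching opposite letters. -/
def stackCount : List Bool → List Bool → ℕ
  | [], [] => 1
  | [], _ :: _ => 0
  | b :: w, [] => stackCount w [b]
  | b :: w, c :: s => stackCount w (b :: c :: s) + if c = !b then stackCount w s else 0

/-- Raney numbers: the coefficient of `z ^ n` in `F ^ r`, where `F = 1 + z F ^ (m + 1)`. -/
def raney (m : ℕ) : ℕ → ℕ → ℕ
  | 0, _ => 1
  | _ + 1, 0 => 0
  | n + 1, r + 1 => raney m (n + 1) r + raney m n (r + m + 1)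

/-- Double induction along `F^(r+1) = F^r + z F^(r+m+1)`. The form without division needs no
exception at `n = r = 0`. -/
theorem raney_closed_form (m n r : ℕ) :
    (raney m n r : ℚ) * ((m + 1) * n + r) = r * ((m + 1) * n + r).choose n := by
  induction n generalizing r with
  | zero => simp [raney]
  | succ n ihn =>
    induction r with
    | zero => simp [raney]
    | succ r ihr =>
      have h1 := ihn (r + m + 1)
      have hA : (m + 1) * n + (r + m + 1) = (m + 1) * (n + 1) + r := by ring
      rw [hA] at h1
      have hs : (m + 1) * (n + 1) + (r + 1) = ((m + 1) * (n + 1) + r) + 1 := by ring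
      rw [hs, Nat.choose_succ_succ, raney]
      have hch := Nat.choose_succ_right_eq ((m + 1) * (n + 1) + r) n
      have hle : n ≤ (m + 1) * (n + 1) + r := by nlinarith
      have hch' : (((m + 1) * (n + 1) + r).choose (n + 1) : ℚ) * (n + 1) =
          ((m + 1) * (n + 1) + r).choose n * ((m + 1) * (n + 1) + r - n) := by
        have := congrArg (Nat.cast : ℕ → ℚ) hch
        push_cast [Nat.cast_sub hle] at this
        exact this
      push_cast at *
      generalize (((m + 1) * (n + 1) + r).choose (n + 1) : ℚ) = c1 at *
      generalize (((m + 1) * (n + 1) + r).choose n : ℚ) = c0 at *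
      generalize (raney m (n + 1) r : ℚ) = x at *
      generalize (raney m n (r + m + 1) : ℚ) = y at *
      -- Both induction hypotheses carry this factor, so the goal is multiplied by it.
      have hpos : ((m : ℚ) + 1) * (n + 1) + r ≠ 0 := by positivity
      apply mul_left_cancel₀ hpos
      linear_combination (((m : ℚ) + 1) * (n + 1) + r + 1) * ihr +
        (((m : ℚ) + 1) * (n + 1) + r + 1) * h1 - (m + 1) * hch'

theorem raney_one (m p : ℕ) :
    (raney m p 1 : ℝ) = 1 / ((m : ℝ) * (p : ℝ) + 1) * (Nat.choose (m * p + p) p : ℝ) := by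
  have h := raney_closed_form m p 1
  have h' : (raney m p 1 : ℝ) * ((m + 1) * p + 1) = ((m + 1) * p + 1).choose p := by
    have := congrArg (Rat.cast : ℚ → ℝ) h
    push_cast at this
    linarith
  have hc := Nat.choose_mul_succ_eq (m * p + p) p
  have e1 : m * p + p + 1 - p = m * p + 1 := by omega
  have e2 : (m + 1) * p + 1 = m * p + p + 1 := by ring
  rw [e1] at hc
  rw [e2] at h'
  have hc' := congrArg (Nat.cast : ℕ → ℝ) hc
  push_cast at hc'
  have p1 : (m : ℝ) * p + 1 ≠ 0 := by positivity
  have p2 : (m : ℝ) * p + p + 1 ≠ 0 := by positivity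
  rw [one_div, inv_mul_eq_div, eq_div_iff p1]
  apply mul_right_cancel₀ p2
  rw [hc', ← h']
  ring

/-! ### Completions of a stack as powers of the generating function -/

/-- Exponent of the Raney number counting the completions of a stack at height `h`; the Boolean is
the direction of the next letter. -/
def completionExponent (m : ℕ) : Bool → ℕ → List Bool → ℕ
  | true, h, [] => m + 1 - h
  | false, _, [] => 1
  | true, h, true :: s => m + 1 - h + completionExponent m false (h - 1) s
  | false, h, true :: s => 1 + completionExponent m false (h - 1) s
  | true, h, false :: s => 1 + completionExponent m true (h + 1) s
  | false, h, false :: s => h + 1 + completionExponent m true (h + 1) s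

/-- The number of turns from down to up which the completion of a stack forces. -/
def forcedTurns : Bool → List Bool → ℕ
  | _, [] => 0
  | _, true :: s => forcedTurns false s
  | true, false :: s => forcedTurns true s
  | false, false :: s => forcedTurns true s + 1

/-- The stack describes a path from height `0` to height `h` inside `[0, m]`. -/
def IsStackPath (m : ℕ) : ℕ → List Bool → Prop
  | h, [] => h = 0
  | h, true :: s => 1 ≤ h ∧ IsStackPath m (h - 1) s
  | h, false :: s => h + 1 ≤ m ∧ IsStackPath m (h + 1) s

/-- The word `(a^m b^m)^n`. -/
def blockWord (m n : ℕ) : List Bool :=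
  (List.replicate n (List.replicate m true ++ List.replicate m false)).flatten

theorem blockWord_succ (m n : ℕ) : blockWord m (n + 1) =
    List.replicate m true ++ (List.replicate m false ++ blockWord m n) := by
  simp [blockWord, List.replicate_succ]

/-- The coefficient of `z ^ n` in `z ^ t F ^ r`, where `F = 1 + z F ^ (m + 1)`. -/
def shiftedRaney (m n t r : ℕ) : ℕ :=
  if t ≤ n then raney m (n - t) r else 0

/-- The number of completions predicted in terms of Raney numbers. -/
def completionCount (m : ℕ) (d : Bool) (h n : ℕ) (s : List Bool) : ℕ :=
  shiftedRaney m n (forcedTurns d s) (completionExponent m d h s)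

/-- This is `F = 1 + z F^(m+1)` multiplied by `z^t F^e`. The two terms on the right will be the push
and the pop available at a letter opposite to the top of the stack. -/
theorem shiftedRaney_one_add (m n t e : ℕ) :
    shiftedRaney m n t (1 + e) =
      shiftedRaney m n (t + 1) (e + m + 1) + shiftedRaney m n t e := by
  unfold shiftedRaney
  rcases lt_trichotomy t n with h | h | h
  · obtain ⟨k, rfl⟩ : ∃ k, n = t + 1 + k := ⟨n - (t + 1), by omega⟩
    have e1 : t + 1 + k - t = k + 1 := by omega
    have e2 : t + 1 + k - (t + 1) = k := by omega
    have h2 : t + 1 ≤ t + 1 + k := by omega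
    have h3 : t ≤ t + 1 + k := by omega
    rw [if_pos h3, if_pos h2, if_pos h3, e1, e2, add_comm 1 e, raney, add_comm]
  · subst h
    simp [raney]
  · rw [if_neg (by omega), if_neg (by omega), if_neg (by omega)]

/-- Pushing a letter and cancelling its opposite move the height by the same amount, so the height
depends only on the position in the word and the stack stays a path in `[0, m]`. If the top is
opposite to the letter read, a push gives exponent `e + m + 1` and one more turn, a pop gives `e`,
and `shiftedRaney_one_add` adds them. Otherwise only a push is possible, and the exponent does not
change. -/
theorem stackCount_up (m n : ℕ)
    (hdown : ∀ s, IsStackPath m m s → stackCount (List.replicate m false ++ blockWord m n) s =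
      completionCount m false m n s) (hm : 1 ≤ m) (k h : ℕ) (hk : k + h = m) (s : List Bool)
    (hs : IsStackPath m h s) :
    stackCount (List.replicate k true ++ (List.replicate m false ++ blockWord m n)) s =
      completionCount m true h n s := by
  induction k generalizing h s with
  | zero =>
    obtain rfl : h = m := by omega
    simp only [List.replicate_zero, List.nil_append]
    rw [hdown s hs]
    -- At height `m ≥ 1` the stack is nonempty with an up letter on top, and `m + 1 - m = 1` makes
    -- the exponents for both directions agree.
    match s, hs with
    | [], hs => simp [IsStackPath] at hs; omega
    | true :: s, hs => simp [completionCount, forcedTurns, completionExponent]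
    | false :: s, hs => simp [IsStackPath] at hs
  | succ k ih =>
    rw [List.replicate_succ, List.cons_append]
    match s, hs with
    | [], hs =>
      simp only [IsStackPath] at hs
      subst hs
      rw [stackCount, ih 1 (by omega) [true] (by simp [IsStackPath])]
      simp [completionCount, forcedTurns, completionExponent]
    | true :: s, hs =>
      rw [stackCount, ih (h + 1) (by omega) _ (by simpa [IsStackPath] using hs)]
      have : m + 1 - (h + 1) + (1 + completionExponent m false (h - 1) s) =
        m + 1 - h + completionExponent m false (h - 1) s := by omega
      simp [completionCount, forcedTurns, completionExponent, ← this]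
    | false :: s, hs =>
      rw [stackCount, ih (h + 1) (by omega) _ (by simpa [IsStackPath] using hs),
        ih (h + 1) (by omega) s hs.2]
      have := shiftedRaney_one_add m n (forcedTurns true s) (completionExponent m true (h + 1) s)
      have e1 : m + 1 - (h + 1) + (h + 1 + completionExponent m true (h + 1) s) =
        completionExponent m true (h + 1) s + m + 1 := by omega
      simp only [completionCount, forcedTurns, completionExponent, Nat.add_sub_cancel, e1, this]
      simp

theorem stackCount_down (m n : ℕ)
    (hbase : ∀ s, IsStackPath m 0 s → stackCount (blockWord m n) s =
      completionCount m false 0 n s) (h : ℕ) (hh : h ≤ m) (s : List Bool)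
    (hs : IsStackPath m h s) :
    stackCount (List.replicate h false ++ blockWord m n) s = completionCount m false h n s := by
  induction h generalizing s with
  | zero => simpa using hbase s hs
  | succ h ih =>
    rw [List.replicate_succ, List.cons_append]
    match s, hs with
    | [], hs => simp [IsStackPath] at hs
    | true :: s, hs =>
      have hs' : IsStackPath m h s := by simpa [IsStackPath] using hs
      rw [stackCount, ih (by omega) _ (by simpa [IsStackPath] using ⟨by omega, hs'⟩),
        ih (by omega) s hs']
      have := shiftedRaney_one_add m n (forcedTurns false s) (completionExponent m false h s)
      have e1 : h + 1 + (m + 1 - (h + 1) + completionExponent m false h s) =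
        completionExponent m false h s + m + 1 := by omega
      simp only [completionCount, forcedTurns, completionExponent, Nat.add_sub_cancel, e1, this]
      simp
    | false :: s, hs =>
      rw [stackCount, ih (by omega) _ (by simpa [IsStackPath] using ⟨by omega, hs⟩)]
      simp only [completionCount, forcedTurns, completionExponent, ← add_assoc]
      simp

/-- A block is one climb and one descent, so `stackCount_up` and `stackCount_down` reduce `n + 1`
blocks to `n`. With no block left, a nonempty stack at height `0` has a down letter on top; it
forces a turn, so both sides vanish. -/
theorem stackCount_blockWord (m n : ℕ) (hm : 1 ≤ m) (s : List Bool) (hs : IsStackPath m 0 s) :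
    stackCount (blockWord m n) s = completionCount m false 0 n s := by
  induction n generalizing s with
  | zero =>
    match s, hs with
    | [], hs => simp [blockWord, stackCount, completionCount, shiftedRaney, forcedTurns, raney]
    | true :: s, hs => simp [IsStackPath] at hs
    | false :: s, hs =>
      simp [blockWord, stackCount, completionCount, shiftedRaney, forcedTurns]
  | succ n ih =>
    rw [blockWord_succ, stackCount_up m n (fun s hs => stackCount_down m n ih m le_rfl s hs) hm m 0
      (by simp) s hs]
    match s, hs with
    -- Since `raney m (n + 1) 0 = 0`, the coefficient of `z^(n+1)` in `F` is that of `z^n` in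
    -- `F^(m+1)`.
    | [], hs => simp [completionCount, shiftedRaney, forcedTurns, completionExponent, raney]
    | true :: s, hs => simp [IsStackPath] at hs
    | false :: s, hs =>
      simp [completionCount, shiftedRaney, forcedTurns, completionExponent]

theorem stackCount_blockWord_nil (m p : ℕ) (hm : 1 ≤ m) :
    (stackCount (blockWord m p) [] : ℝ) =
      1 / ((m : ℝ) * (p : ℝ) + 1) * (Nat.choose (m * p + p) p : ℝ) := by
  rw [← raney_one, stackCount_blockWord m p hm [] rfl]
  simp [completionCount, shiftedRaney, forcedTurns, completionExponent]

/-! ### Walks along a word -/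

section Walks

variable {V : Type*}

/-- The matrix position used by a step from `i` to `j`: letters `true` are traversed forwards and
letters `false` backwards. -/
def stepEdge (b : Bool) (i j : V) : V × V := if b then (i, j) else (j, i)

/-- The edges, with letters, used by a walk that starts at a vertex and reads a word. -/
def walkSteps : List Bool → V → List V → List ((V × V) × Bool)
  | b :: w, c, j :: l => (stepEdge b c j, b) :: walkSteps w j l
  | [], _, _ => []
  | _ :: _, _, [] => []

/-- The edges lying on a stack of vertices and letters with current vertex `c`. -/
def stackSteps : V → List (V × Bool) → List ((V × V) × Bool)
  | _, [] => []
  | c, (p, b) :: st => (stepEdge b p c, b) :: stackSteps p st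

theorem stepEdge_not (b : Bool) (i j : V) : stepEdge (!b) i j = stepEdge b j i := by
  cases b <;> rfl

theorem stepEdge_mem {b : Bool} {i j : V} {S : Set V} (hi : i ∈ S) (hj : j ∈ S) :
    (stepEdge b i j).1 ∈ S ∧ (stepEdge b i j).2 ∈ S := by
  cases b <;> simp [stepEdge, hi, hj]

theorem left_mem_stepEdge (b : Bool) (i j : V) :
    i = (stepEdge b i j).1 ∨ i = (stepEdge b i j).2 := by
  cases b <;> simp [stepEdge]

theorem right_mem_stepEdge (b : Bool) (i j : V) :
    j = (stepEdge b i j).1 ∨ j = (stepEdge b i j).2 := by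
  cases b <;> simp [stepEdge]

theorem mem_of_mem_stackSteps {e : V × V} {c : V} {st : List (V × Bool)}
    (he : e ∈ (stackSteps c st).map Prod.fst) :
    e.1 ∈ c :: st.map Prod.fst ∧ e.2 ∈ c :: st.map Prod.fst := by
  induction st generalizing c with
  | nil => simp [stackSteps] at he
  | cons pb st ih =>
    obtain ⟨p, b⟩ := pb
    simp only [stackSteps, List.map_cons, List.mem_cons] at he ⊢
    rcases he with rfl | he
    · cases b <;> simp [stepEdge]
    · have := ih he
      simp only [List.mem_cons] at this
      tauto

/-- The state of an exploration: `H` are the steps made so far, `S` the visited vertices, `st` the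
stack, `c` the current vertex and `C` the edges traversed in both directions. -/
structure IsTreeState (H : List ((V × V) × Bool)) (S : Finset V) (st : List (V × Bool)) (c : V)
    (C : List (V × V)) : Prop where
  perm : H.Perm (stackSteps c st ++ (C.map (fun e => (e, true)) ++ C.map (fun e => (e, false))))
  nodup : ((stackSteps c st).map Prod.fst ++ C).Nodup
  card : ((stackSteps c st).map Prod.fst ++ C).length + 1 = S.card
  mem : ∀ e ∈ (stackSteps c st).map Prod.fst ++ C, e.1 ∈ S ∧ e.2 ∈ S
  vertex_nodup : (c :: st.map Prod.fst).Nodup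
  vertex_mem : ∀ v ∈ c :: st.map Prod.fst, v ∈ S

theorem IsTreeState.init (r : V) : IsTreeState [] {r} [] r [] := by
  constructor <;> simp [stackSteps]

/-- Away from the diagonal, a matrix position together with the departure vertex determines the
letter; recrossing an edge from its other end forces the opposite letter. -/
theorem stepEdge_eq_iff {a b : Bool} {c j p : V} (hne : p ≠ c) :
    stepEdge b c j = stepEdge a p c ↔ j = p ∧ a = !b := by
  cases a <;> cases b <;> simp [stepEdge, hne, eq_comm]
  all_goals grind

theorem IsTreeState.map_fst_perm {H : List ((V × V) × Bool)} {S : Finset V} {st : List (V × Bool)}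
    {c : V} {C : List (V × V)} (h : IsTreeState H S st c C) :
    (H.map Prod.fst).Perm ((stackSteps c st).map Prod.fst ++ (C ++ C)) := by
  have := h.perm.map Prod.fst
  simpa [Function.comp_def] using this

variable [DecidableEq V]

/-- The walk explores a tree: each step either goes to a new vertex (a push), or it goes back to
the parent of the current vertex with the letter opposite to the one used on the way out (a pop),
and the stack is empty at the end. -/
def IsTreeWalk : Finset V → List (V × Bool) → V → List Bool → List V → Prop
  | _, st, _, [], [] => st = []
  | S, [], c, b :: w, j :: l => j ∉ S ∧ IsTreeWalk (insert j S) [(c, b)] j w l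
  | S, (p, a) :: st, c, b :: w, j :: l =>
      if j ∉ S then IsTreeWalk (insert j S) ((c, b) :: (p, a) :: st) j w l
      else (j = p ∧ a = !b) ∧ IsTreeWalk S st p w l
  | _, _, _, _, _ => False

/-- The new edge ends outside `S` while all earlier edges lie inside `S`, so edges stay distinct and
the count of vertices against edges is preserved. -/
theorem IsTreeState.push {H : List ((V × V) × Bool)} {S : Finset V} {st : List (V × Bool)} {c j : V}
    {C : List (V × V)} (h : IsTreeState H S st c C) (b : Bool) (hj : j ∉ S) :
    IsTreeState (H ++ [(stepEdge b c j, b)]) (insert j S) ((c, b) :: st) j C where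
  perm := by
    simp only [stackSteps, List.cons_append]
    exact (List.perm_append_singleton _ _).trans (h.perm.cons _)
  nodup := by
    simp only [stackSteps, List.map_cons, List.cons_append, List.nodup_cons]
    refine ⟨fun hm => hj ?_, h.nodup⟩
    have := h.mem _ hm
    rcases right_mem_stepEdge b c j with e | e
    · rw [e]; exact this.1
    · rw [e]; exact this.2
  card := by
    rw [Finset.card_insert_of_notMem hj, ← h.card]
    simp [stackSteps]
  mem := by
    simp only [stackSteps, List.map_cons, List.cons_append, List.mem_cons, Finset.mem_insert]
    rintro e (rfl | he)
    · have hc := h.vertex_mem c (by simp)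
      cases b <;> simp [stepEdge, hc]
    · exact ⟨Or.inr (h.mem e he).1, Or.inr (h.mem e he).2⟩
  vertex_nodup := by
    rw [List.nodup_cons]
    exact ⟨fun hm => hj (h.vertex_mem j (by simpa using hm)), h.vertex_nodup⟩
  vertex_mem := by
    intro v hv
    rw [Finset.mem_insert]
    rcases List.mem_cons.1 hv with rfl | hv
    · exact Or.inl rfl
    · exact Or.inr (h.vertex_mem v (by simpa using hv))

/-- The top edge passes from the stack to the closed edges; no vertex or edge is created. -/
theorem IsTreeState.pop {H : List ((V × V) × Bool)} {S : Finset V} {st : List (V × Bool)} {c p : V}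
    {C : List (V × V)} {b : Bool} (h : IsTreeState H S ((p, !b) :: st) c C) :
    IsTreeState (H ++ [(stepEdge b c p, b)]) S st p (stepEdge b c p :: C) := by
  have hst : stackSteps c ((p, !b) :: st) = (stepEdge b c p, !b) :: stackSteps p st := by
    rw [stackSteps, stepEdge_not]
  have hmid : ((stackSteps c ((p, !b) :: st)).map Prod.fst ++ C).Perm
      ((stackSteps p st).map Prod.fst ++ stepEdge b c p :: C) := by
    rw [hst]
    simpa using List.perm_middle.symm
  refine ⟨?_, hmid.nodup_iff.1 h.nodup, hmid.length_eq ▸ h.card,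
    fun e he => h.mem e (hmid.mem_iff.2 he), (List.nodup_cons.1 h.vertex_nodup).2,
    fun v hv => h.vertex_mem v (List.mem_cons_of_mem _ hv)⟩
  refine (List.perm_append_singleton _ _).trans ((h.perm.cons _).trans ?_)
  rw [hst]
  rw [List.perm_iff_count]
  intro x
  simp only [List.map_cons, List.cons_append, List.count_cons, List.count_append]
  cases b
  · simp; omega
  · simp; omega

/-- The final stack is empty, so the invariant `perm` then says that each edge is crossed once with
each letter. -/
theorem IsTreeWalk.exists_state {H : List ((V × V) × Bool)} {S : Finset V} {st : List (V × Bool)}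
    {c : V} {C : List (V × V)} {w : List Bool} {l : List V} (hw : IsTreeWalk S st c w l)
    (h : IsTreeState H S st c C) :
    ∃ C', IsTreeState (H ++ walkSteps w c l) (S ∪ l.toFinset) [] (l.getLastD c) C' := by
  induction w generalizing H S st c C l with
  | nil =>
    match l, hw with
    | [], hw =>
      rw [IsTreeWalk] at hw
      subst hw
      exact ⟨C, by simpa [walkSteps] using h⟩
    | _ :: _, hw => simp [IsTreeWalk] at hw
  | cons b w ih =>
    match l, st, hw, h with
    | [], [], hw, h => simp [IsTreeWalk] at hw
    | [], _ :: _, hw, h => simp [IsTreeWalk] at hw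
    | j :: l, [], hw, h =>
      rw [IsTreeWalk] at hw
      obtain ⟨C', h'⟩ := ih hw.2 (h.push b hw.1)
      refine ⟨C', ?_⟩
      rw [List.append_assoc] at h'
      rw [List.getLastD_cons]
      simpa [walkSteps, Finset.insert_union, Finset.union_insert] using h'
    | j :: l, (p, a) :: st, hw, h =>
      rw [IsTreeWalk] at hw
      split_ifs at hw with hj
      · obtain ⟨⟨rfl, rfl⟩, hw⟩ := hw
        obtain ⟨C', h'⟩ := ih hw h.pop
        refine ⟨C', ?_⟩
        rw [List.append_assoc] at h'
        rw [List.getLastD_cons]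
        have hj' : j ∈ S ∪ l.toFinset := Finset.mem_union_left _ hj
        simpa [walkSteps, Finset.union_insert, Finset.insert_eq_of_mem hj'] using h'
      · obtain ⟨C', h'⟩ := ih hw (h.push b hj)
        refine ⟨C', ?_⟩
        rw [List.append_assoc] at h'
        rw [List.getLastD_cons]
        simpa [walkSteps, Finset.insert_union, Finset.union_insert] using h'

/-- The first vertex of the walk that led to the given stack. -/
def stackRoot : V → List (V × Bool) → V
  | c, [] => c
  | _, (p, _) :: st => stackRoot p st

theorem IsTreeWalk.getLastD_eq {S : Finset V} {st : List (V × Bool)}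
    {c : V} {w : List Bool} {l : List V} (hw : IsTreeWalk S st c w l) :
    l.getLastD c = stackRoot c st := by
  induction w generalizing S st c l with
  | nil =>
    match l, hw with
    | [], hw =>
      rw [IsTreeWalk] at hw
      subst hw
      rfl
    | _ :: _, hw => simp [IsTreeWalk] at hw
  | cons b w ih =>
    match l, st, hw with
    | [], [], hw => simp [IsTreeWalk] at hw
    | [], _ :: _, hw => simp [IsTreeWalk] at hw
    | j :: l, [], hw =>
      rw [IsTreeWalk] at hw
      rw [List.getLastD_cons, ih hw.2]
      rfl
    | j :: l, (p, a) :: st, hw =>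
      rw [IsTreeWalk] at hw
      rw [List.getLastD_cons]
      split_ifs at hw with hj
      · obtain ⟨⟨rfl, rfl⟩, hw⟩ := hw
        rw [ih hw]
        rfl
      · rw [ih hw]
        rfl

/-- A step to a new vertex uses a new edge, because the edges of `E` have both ends in `S`. So the
vertex count grows no faster than the edge count. -/
theorem card_vertices_add_le (w : List Bool) (c : V) (l : List V) (hl : l.length = w.length)
    (S : Finset V) (E : Finset (V × V)) (hc : c ∈ S) (hE : ∀ e ∈ E, e.1 ∈ S ∧ e.2 ∈ S) :
    (S ∪ l.toFinset).card + E.card ≤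
      S.card + (E ∪ ((walkSteps w c l).map Prod.fst).toFinset).card := by
  induction w generalizing c l S E with
  | nil =>
    obtain rfl : l = [] := by simpa using hl
    simp [walkSteps]
  | cons b w ih =>
    match l, hl with
    | j :: l, hl =>
      have hE' : ∀ e ∈ insert (stepEdge b c j) E, e.1 ∈ insert j S ∧ e.2 ∈ insert j S := by
        intro e he
        rcases Finset.mem_insert.1 he with rfl | he
        · cases b <;> simp [stepEdge, hc]
        · exact ⟨Finset.mem_insert_of_mem (hE e he).1, Finset.mem_insert_of_mem (hE e he).2⟩
      have h := ih j l (by simpa using hl) (insert j S) (insert (stepEdge b c j) E)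
        (Finset.mem_insert_self _ _) hE'
      have e1 : S ∪ (j :: l).toFinset = insert j S ∪ l.toFinset := by
        simp [Finset.insert_union, Finset.union_insert]
      have e2 : E ∪ ((walkSteps (b :: w) c (j :: l)).map Prod.fst).toFinset =
          insert (stepEdge b c j) E ∪ ((walkSteps w j l).map Prod.fst).toFinset := by
        simp [walkSteps, Finset.insert_union, Finset.union_insert]
      rw [e1, e2]
      by_cases hj : j ∈ S
      · rw [Finset.insert_eq_of_mem hj] at h ⊢
        have := Finset.card_le_card (Finset.subset_insert (stepEdge b c j) E)
        omega
      · have hne : stepEdge b c j ∉ E := by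
          intro hm
          rcases right_mem_stepEdge b c j with e | e
          · exact hj (e ▸ (hE _ hm).1)
          · exact hj (e ▸ (hE _ hm).2)
        rw [Finset.card_insert_of_notMem hj, Finset.card_insert_of_notMem hne] at h
        omega

/-- Extremality leaves no choice: a step to a visited vertex can only go back along the top edge of
the stack. The hypotheses concern the whole walk, past and future, so they pass unchanged through
the induction. -/
theorem IsTreeState.isTreeWalk {H : List ((V × V) × Bool)} {S : Finset V} {st : List (V × Bool)}
    {c : V} {C : List (V × V)} (w : List Bool) (l : List V) (hl : l.length = w.length)
    (h : IsTreeState H S st c C)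
    (hcard : ((H ++ walkSteps w c l).map Prod.fst).toFinset.card + 1 ≤ (S ∪ l.toFinset).card)
    (hcount : ∀ e ∈ (H ++ walkSteps w c l).map Prod.fst,
      ((H ++ walkSteps w c l).map Prod.fst).count e = 2) :
    IsTreeWalk S st c w l := by
  induction w generalizing H S st c C l with
  | nil =>
    obtain rfl : l = [] := by simpa using hl
    rw [IsTreeWalk]
    match st, h with
    | [], _ => rfl
    | (p, a) :: st, h =>
      -- An edge still on the stack has been crossed only once.
      exfalso
      have hp := h.map_fst_perm
      have hn := h.nodup
      simp only [walkSteps, List.append_nil] at hcount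
      have hmem : stepEdge a p c ∈ H.map Prod.fst := hp.mem_iff.2 (by simp [stackSteps])
      have h2 := hcount _ hmem
      rw [hp.count_eq] at h2
      simp only [stackSteps, List.map_cons, List.cons_append, List.nodup_cons, List.mem_append,
        not_or] at hn
      rw [stackSteps, List.map_cons, List.cons_append, List.count_cons_self, List.count_append,
        List.count_append, List.count_eq_zero_of_not_mem hn.1.1,
        List.count_eq_zero_of_not_mem hn.1.2] at h2
      omega
  | cons b w ih =>
    match l, hl with
    | j :: l, hl =>
      have hl' : l.length = w.length := by simpa using hl
      have e0 : H ++ walkSteps (b :: w) c (j :: l) =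
          (H ++ [(stepEdge b c j, b)]) ++ walkSteps w j l := by simp [walkSteps]
      have e1 : S ∪ (j :: l).toFinset = insert j S ∪ l.toFinset := by
        simp [Finset.insert_union, Finset.union_insert]
      rw [e0] at hcount hcard
      rw [e1] at hcard
      by_cases hj : j ∈ S
      · rw [Finset.insert_eq_of_mem hj] at hcard
        have hp := h.map_fst_perm
        have hc : c ∈ S := h.vertex_mem c (by simp)
        -- A new edge between visited vertices would make the edges at least as numerous as the
        -- vertices.
        have hold : stepEdge b c j ∈ H.map Prod.fst := by
          by_contra hnew
          have hA := card_vertices_add_le w j l hl' S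
            (((H ++ [(stepEdge b c j, b)]).map Prod.fst).toFinset) hj (by
              intro e he
              simp only [List.map_append, List.map_cons, List.map_nil, List.mem_toFinset,
                List.mem_append, List.mem_singleton] at he
              rcases he with he | rfl
              · apply h.mem
                have := hp.mem_iff.1 he
                simp only [List.mem_append] at this ⊢
                tauto
              · exact stepEdge_mem (S := (S : Set V)) hc hj)
          have hE : ((H ++ [(stepEdge b c j, b)]).map Prod.fst).toFinset =
              insert (stepEdge b c j) ((stackSteps c st).map Prod.fst ++ C).toFinset := by
            ext e
            have := hp.mem_iff (a := e)
            simp only [List.map_append, List.map_cons, List.map_nil, List.mem_toFinset,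
              List.mem_append, List.mem_singleton, Finset.mem_insert] at this ⊢
            tauto
          have hnew' : stepEdge b c j ∉ ((stackSteps c st).map Prod.fst ++ C).toFinset := by
            intro hm
            apply hnew
            rw [hp.mem_iff]
            simp only [List.mem_toFinset, List.mem_append] at hm ⊢
            tauto
          have hcardE : ((H ++ [(stepEdge b c j, b)]).map Prod.fst).toFinset.card = S.card := by
            rw [hE, Finset.card_insert_of_notMem hnew', List.toFinset_card_of_nodup h.nodup, h.card]
          rw [hcardE, ← List.toFinset_append, ← List.map_append] at hA
          omega
        -- A closed edge has been crossed twice already; this would be a third time.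
        have hC : stepEdge b c j ∉ C := by
          intro hm
          have h2 := hcount (stepEdge b c j) (by simp)
          rw [List.map_append, List.count_append, List.map_append, List.count_append,
            hp.count_eq, List.count_append, List.count_append] at h2
          have := List.count_pos_iff.2 hm
          simp at h2
          omega
        have hS : stepEdge b c j ∈ (stackSteps c st).map Prod.fst := by
          have := hp.mem_iff.1 hold
          simp only [List.mem_append] at this
          tauto
        match st, h, hS with
        | [], h, hS => simp [stackSteps] at hS
        | (p, a) :: st, h, hS =>
          have hv := h.vertex_nodup
          simp only [List.map_cons, List.nodup_cons] at hv
          have hpc : p ≠ c := fun e => hv.1 (by simp [e])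
          have hja : j = p ∧ a = !b := by
            rw [stackSteps, List.map_cons, List.mem_cons] at hS
            rcases hS with hS | hS
            · exact (stepEdge_eq_iff hpc).1 hS
            · exfalso
              -- Edges below the top have both ends among the lower stack vertices, which do not
              -- include `c`.
              have := mem_of_mem_stackSteps hS
              rcases left_mem_stepEdge b c j with e | e
              · exact hv.1 (e ▸ this.1)
              · exact hv.1 (e ▸ this.2)
          obtain ⟨rfl, rfl⟩ := hja
          rw [IsTreeWalk, if_neg (not_not.2 hj)]
          exact ⟨⟨rfl, rfl⟩, ih l hl' h.pop hcard hcount⟩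
      · have h' := ih l hl' (h.push b hj) hcard hcount
        cases st with
        | nil => exact ⟨hj, h'⟩
        | cons pa st => rw [IsTreeWalk, if_pos hj]; exact h'

/-- A walk which does not explore a tree has too few vertices, or it has an edge which is not
traversed exactly twice. -/
theorem card_le_or_exists_count_ne (w : List Bool) (r : V) (l : List V) (hl : l.length = w.length)
    (h : ¬ IsTreeWalk {r} [] r w l) :
    ({r} ∪ l.toFinset).card ≤ ((walkSteps w r l).map Prod.fst).toFinset.card ∨
      ({r} ∪ l.toFinset).card ≤ ((walkSteps w r l).map Prod.fst).toFinset.card + 1 ∧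
        ∃ e ∈ (walkSteps w r l).map Prod.fst, ((walkSteps w r l).map Prod.fst).count e ≠ 2 := by
  have hA := card_vertices_add_le w r l hl {r} ∅ (by simp) (by simp)
  simp only [Finset.card_empty, Finset.empty_union, Finset.card_singleton] at hA
  by_contra hcon
  push Not at hcon
  refine h ((IsTreeState.init r).isTreeWalk w l hl ?_ ?_)
  · simpa using hcon.1
  · simpa using hcon.2 (by omega)

theorem IsTreeWalk.exists_perm {w : List Bool} {r : V} {l : List V}
    (h : IsTreeWalk {r} [] r w l) :
    l.getLastD r = r ∧ ∃ C : List (V × V), C.Nodup ∧ C.length + 1 = ({r} ∪ l.toFinset).card ∧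
      (walkSteps w r l).Perm (C.map (fun e => (e, true)) ++ C.map (fun e => (e, false))) := by
  refine ⟨h.getLastD_eq, ?_⟩
  obtain ⟨C, hC⟩ := h.exists_state (IsTreeState.init r)
  exact ⟨C, by simpa [stackSteps] using hC.nodup, by simpa [stackSteps] using hC.card,
    by simpa [stackSteps] using hC.perm⟩

end Walks

/-! ### Weighted counts of walks -/

section WeightedCounts

/-- The weighted number of ways to read a word as a tree walk when `s` vertices have been visited
and a step to a new vertex carries the weight `1 - s * ε`. -/
def stackWeight (ε : ℝ) : List Bool → ℕ → List Bool → ℝ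
  | [], _, [] => 1
  | [], _, _ :: _ => 0
  | b :: w, s, [] => (1 - s * ε) * stackWeight ε w (s + 1) [b]
  | b :: w, s, a :: st => (1 - s * ε) * stackWeight ε w (s + 1) (b :: a :: st) +
      if a = !b then stackWeight ε w s st else 0

theorem tendsto_stackWeight {ι : Type*} {f : Filter ι} {ε : ι → ℝ} (hε : Tendsto ε f (𝓝 0))
    (w : List Bool) (s : ℕ) (st : List Bool) :
    Tendsto (fun i => stackWeight (ε i) w s st) f (𝓝 (stackCount w st)) := by
  have h1 : ∀ s : ℕ, Tendsto (fun i => 1 - (s : ℝ) * ε i) f (𝓝 1) := fun s => by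
    simpa using tendsto_const_nhds.sub (hε.const_mul (s : ℝ))
  induction w generalizing s st with
  | nil =>
    cases st with
    | nil => simpa [stackWeight, stackCount] using tendsto_const_nhds
    | cons a st => simpa [stackWeight, stackCount] using tendsto_const_nhds
  | cons b w ih =>
    cases st with
    | nil => simpa [stackWeight, stackCount] using (h1 s).mul (ih (s + 1) [b])
    | cons a st =>
      have h2 := (h1 s).mul (ih (s + 1) (b :: a :: st))
      simp only [stackWeight, stackCount]
      split_ifs
      · simpa using h2.add (ih s st)
      · simpa using h2

/-- Bound for the sum of `ε ^ (number of new vertices)` over all walks of length `n` from a state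
in which `s` of the `1 / ε` vertices have been visited. -/
def walkBound : ℕ → ℕ → ℝ
  | 0, _ => 1
  | n + 1, s => s * walkBound n s + walkBound n (s + 1)

variable {V : Type*} [Fintype V]

theorem sum_ofFn_succ {M : Type*} [AddCommMonoid M] (n : ℕ) (f : List V → M) :
    ∑ v : Fin (n + 1) → V, f (List.ofFn v) = ∑ j, ∑ v : Fin n → V, f (j :: List.ofFn v) := by
  rw [← (Fin.consEquiv fun _ => V).sum_comp, Fintype.sum_prod_type]
  simp [Fin.consEquiv, List.ofFn_succ]

variable [DecidableEq V]

/-- The next vertex is one of `S.card` visited ones, or one of at most `1/ε` new ones, each of which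
costs a factor `ε`. Hence the bound depends on `ε` only through `ε ^ S.card`. -/
theorem sum_pow_card_le {ε : ℝ} (hε : 0 ≤ ε) (hV : Fintype.card V * ε = 1) (n : ℕ) (S : Finset V) :
    ∑ v : Fin n → V, ε ^ (S ∪ (List.ofFn v).toFinset).card ≤ ε ^ S.card * walkBound n S.card := by
  induction n generalizing S with
  | zero => simp [walkBound]
  | succ n ih =>
    rw [sum_ofFn_succ n (fun l => ε ^ (S ∪ l.toFinset).card)]
    have e1 : ∀ (j : V) (l : List V), S ∪ (j :: l).toFinset = insert j S ∪ l.toFinset := by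
      intro j l
      simp [Finset.insert_union, Finset.union_insert]
    simp_rw [e1]
    rw [← Finset.sum_add_sum_compl S]
    have h1 : ∑ j ∈ S, ∑ v : Fin n → V, ε ^ (insert j S ∪ (List.ofFn v).toFinset).card ≤
        ∑ _j ∈ S, ε ^ S.card * walkBound n S.card := by
      refine Finset.sum_le_sum fun j hj => ?_
      rw [Finset.insert_eq_of_mem hj]
      exact ih S
    have h2 : ∑ j ∈ Sᶜ, ∑ v : Fin n → V, ε ^ (insert j S ∪ (List.ofFn v).toFinset).card ≤
        ∑ _j ∈ Sᶜ, ε ^ (S.card + 1) * walkBound n (S.card + 1) := by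
      refine Finset.sum_le_sum fun j hj => ?_
      rw [← Finset.card_insert_of_notMem (Finset.mem_compl.1 hj)]
      exact ih _
    have hpos : ∀ n s, 0 ≤ walkBound n s := by
      intro n
      induction n with
      | zero => intro s; simp [walkBound]
      | succ n ihn =>
        intro s
        exact add_nonneg (mul_nonneg (Nat.cast_nonneg _) (ihn s)) (ihn (s + 1))
    have h3 : ∑ _j ∈ Sᶜ, ε ^ (S.card + 1) * walkBound n (S.card + 1) ≤
        ε ^ S.card * walkBound n (S.card + 1) := by
      rw [Finset.sum_const, nsmul_eq_mul]
      have hc : (Sᶜ.card : ℝ) ≤ Fintype.card V := by exact_mod_cast Finset.card_le_univ _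
      calc (Sᶜ.card : ℝ) * (ε ^ (S.card + 1) * walkBound n (S.card + 1))
          ≤ Fintype.card V * (ε ^ (S.card + 1) * walkBound n (S.card + 1)) := by
            have := hpos n (S.card + 1)
            gcongr
        _ = (Fintype.card V * ε) * (ε ^ S.card * walkBound n (S.card + 1)) := by ring
        _ = _ := by rw [hV, one_mul]
    rw [Finset.sum_const, nsmul_eq_mul] at h1
    calc _ ≤ _ := add_le_add h1 (h2.trans h3)
      _ = _ := by rw [walkBound]; ring

-- There are `1/ε - s` new vertices at cost `ε` each, whence the push weight `1 - s * ε`; a pop has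
-- a single possible target. Vertex names therefore drop out and only the letters of the stack
-- remain.
open Classical in
theorem sum_isTreeWalk {ε : ℝ} (hV : Fintype.card V * ε = 1) (w : List Bool) (S : Finset V)
    (st : List (V × Bool)) (c : V) (hst : ∀ v ∈ st.map Prod.fst, v ∈ S) (hc : c ∈ S) :
    ∑ v : Fin w.length → V, (if IsTreeWalk S st c w (List.ofFn v) then
        ε ^ (S ∪ (List.ofFn v).toFinset).card else 0) =
      ε ^ S.card * stackWeight ε w S.card (st.map Prod.snd) := by
  induction w generalizing S st c with
  | nil =>
    cases st with
    | nil => simp [IsTreeWalk, stackWeight]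
    | cons a st => simp [IsTreeWalk, stackWeight]
  | cons b w ih =>
    rw [List.length_cons, sum_ofFn_succ w.length
      (fun l => if IsTreeWalk S st c (b :: w) l then ε ^ (S ∪ l.toFinset).card else 0)]
    have e1 : ∀ (j : V) (l : List V), S ∪ (j :: l).toFinset = insert j S ∪ l.toFinset := by
      intro j l
      simp [Finset.insert_union, Finset.union_insert]
    simp_rw [e1]
    rw [← Finset.sum_add_sum_compl S]
    have hpush : ∑ j ∈ Sᶜ, ∑ v : Fin w.length → V,
        (if IsTreeWalk S st c (b :: w) (j :: List.ofFn v) then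
          ε ^ (insert j S ∪ (List.ofFn v).toFinset).card else 0) =
        ε ^ S.card * ((1 - S.card * ε) * stackWeight ε w (S.card + 1) (b :: st.map Prod.snd)) := by
      have h1 : ∀ j ∈ Sᶜ, ∑ v : Fin w.length → V,
          (if IsTreeWalk S st c (b :: w) (j :: List.ofFn v) then
            ε ^ (insert j S ∪ (List.ofFn v).toFinset).card else 0) =
          ε ^ (S.card + 1) * stackWeight ε w (S.card + 1) (b :: st.map Prod.snd) := by
        intro j hj
        have hj' := Finset.mem_compl.1 hj
        have := ih (insert j S) ((c, b) :: st) j (by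
          intro v hv
          rcases List.mem_cons.1 hv with rfl | hv
          · exact Finset.mem_insert_of_mem hc
          · exact Finset.mem_insert_of_mem (hst v hv)) (Finset.mem_insert_self _ _)
        rw [Finset.card_insert_of_notMem hj'] at this
        rw [List.map_cons] at this
        rw [← this]
        refine Finset.sum_congr rfl fun v _ => ?_
        have : IsTreeWalk S st c (b :: w) (j :: List.ofFn v) ↔
            IsTreeWalk (insert j S) ((c, b) :: st) j w (List.ofFn v) := by
          cases st with
          | nil => simp [IsTreeWalk, hj']
          | cons pa st => simp [IsTreeWalk, hj']
        simp only [this]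
      rw [Finset.sum_congr rfl h1, Finset.sum_const, nsmul_eq_mul, Finset.card_compl,
        Nat.cast_sub (Finset.card_le_univ S), pow_succ]
      linear_combination (ε ^ S.card * stackWeight ε w (S.card + 1) (b :: st.map Prod.snd)) * hV
    rw [hpush]
    cases st with
    | nil =>
      have : ∀ j ∈ S, ∑ v : Fin w.length → V,
          (if IsTreeWalk S [] c (b :: w) (j :: List.ofFn v) then
            ε ^ (insert j S ∪ (List.ofFn v).toFinset).card else 0) = 0 := by
        intro j hj
        simp [IsTreeWalk, hj]
      rw [Finset.sum_eq_zero this]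
      simp [stackWeight]
    | cons pa st =>
      obtain ⟨p, a⟩ := pa
      have hp : p ∈ S := hst p (by simp)
      have h2 : ∀ j ∈ S, ∑ v : Fin w.length → V,
          (if IsTreeWalk S ((p, a) :: st) c (b :: w) (j :: List.ofFn v) then
            ε ^ (insert j S ∪ (List.ofFn v).toFinset).card else 0) =
          if j = p then (if a = !b then
            ε ^ S.card * stackWeight ε w S.card (st.map Prod.snd) else 0) else 0 := by
        intro j hj
        rw [Finset.insert_eq_of_mem hj]
        by_cases hjp : j = p
        · subst hjp
          rw [if_pos rfl]
          by_cases hab : a = !b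
          · rw [if_pos hab, ← ih S st j (fun v hv => hst v (by simp [hv])) hj]
            refine Finset.sum_congr rfl fun v _ => ?_
            simp only [IsTreeWalk, hj, hab, not_true, if_false, true_and, and_self]
          · simp [IsTreeWalk, hj, hab]
        · simp [IsTreeWalk, hj, hjp]
      rw [Finset.sum_congr rfl h2, Finset.sum_ite_eq' S p, if_pos hp]
      simp only [List.map_cons, stackWeight]
      split_ifs <;> ring

end WeightedCounts

/-! ### Path moments -/

section PathMoments

variable {V : Type*}

/-- A table of joint moments `q e a b` (standing for `E X_e ^ a * conj X_e ^ b`) of the entries of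
a matrix whose entries have variance about `ε` and whose other moments are of smaller order. -/
structure IsMomentTable (ε θ : ℝ) (q : V × V → ℕ → ℕ → ℂ) : Prop where
  zero : ∀ e, q e 0 0 = 1
  two : ∀ e a b, a + b = 2 → ‖q e a b‖ ≤ ε
  other : ∀ e a b, a + b ≠ 0 → a + b ≠ 2 → ‖q e a b‖ ≤ ε * θ
  variance : ∀ e, ‖q e 1 1 - ε‖ ≤ ε * θ

variable [DecidableEq V]

theorem count_map_fst (H : List ((V × V) × Bool)) (e : V × V) :
    (H.map Prod.fst).count e = H.count (e, true) + H.count (e, false) := by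
  induction H with
  | nil => simp
  | cons x H ih =>
    obtain ⟨e', b⟩ := x
    simp only [List.map_cons, List.count_cons, ih]
    cases b <;> simp <;> omega

variable [Fintype V]

/-- The expectation of the product of the matrix entries along a walk, in terms of the joint
moments of the entries. -/
noncomputable def pathMoment (q : V × V → ℕ → ℕ → ℂ) (H : List ((V × V) × Bool)) : ℂ :=
  ∏ e, q e (H.count (e, true)) (H.count (e, false))

variable {ε θ : ℝ} {q : V × V → ℕ → ℕ → ℂ}

theorem norm_pathMoment_le (hq : IsMomentTable ε θ q) (hε : 0 ≤ ε) (hθ1 : θ ≤ 1)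
    (H : List ((V × V) × Bool)) : ‖pathMoment q H‖ ≤ ε ^ (H.map Prod.fst).toFinset.card := by
  have h : ∏ e : V × V, (if e ∈ (H.map Prod.fst).toFinset then ε else 1) =
      ε ^ (H.map Prod.fst).toFinset.card := by
    rw [Finset.prod_ite_mem, Finset.univ_inter, Finset.prod_const]
  rw [pathMoment, norm_prod, ← h]
  refine Finset.prod_le_prod (fun _ _ => norm_nonneg _) fun e _ => ?_
  have hcount := count_map_fst H e
  split_ifs with he
  · rw [List.mem_toFinset, ← List.count_pos_iff, hcount] at he
    by_cases h2 : H.count (e, true) + H.count (e, false) = 2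
    · exact hq.two e _ _ h2
    · exact (hq.other e _ _ (by omega) h2).trans (mul_le_of_le_one_right hε hθ1)
  · rw [List.mem_toFinset, ← List.count_pos_iff, hcount] at he
    have h1 : H.count (e, true) = 0 := by omega
    have h2 : H.count (e, false) = 0 := by omega
    simp [h1, h2, hq.zero]

/-- Every distinct edge gives a factor at most `ε`, and the edge `e₀` of exceptional multiplicity
gives `ε * θ`. -/
theorem norm_pathMoment_le_mul (hq : IsMomentTable ε θ q) (hε : 0 ≤ ε) (hθ1 : θ ≤ 1)
    (H : List ((V × V) × Bool))
    (hH : ∃ e ∈ H.map Prod.fst, (H.map Prod.fst).count e ≠ 2) :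
    ‖pathMoment q H‖ ≤ θ * ε ^ (H.map Prod.fst).toFinset.card := by
  obtain ⟨e₀, he₀, hc₀⟩ := hH
  have h : ∏ e : V × V, ((if e ∈ (H.map Prod.fst).toFinset then ε else 1) *
      (if e = e₀ then θ else 1)) = θ * ε ^ (H.map Prod.fst).toFinset.card := by
    rw [Finset.prod_mul_distrib, Finset.prod_ite_mem, Finset.univ_inter, Finset.prod_const,
      Finset.prod_ite_eq' Finset.univ e₀, if_pos (Finset.mem_univ _), mul_comm]
  rw [pathMoment, norm_prod, ← h]
  refine Finset.prod_le_prod (fun _ _ => norm_nonneg _) fun e _ => ?_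
  have hcount := count_map_fst H e
  by_cases hee : e = e₀
  · subst hee
    rw [if_pos (List.mem_toFinset.2 he₀), if_pos rfl]
    rw [hcount] at hc₀
    rw [← List.count_pos_iff, hcount] at he₀
    exact hq.other e _ _ (by omega) hc₀
  rw [if_neg hee, mul_one]
  split_ifs with he
  · rw [List.mem_toFinset, ← List.count_pos_iff, hcount] at he
    by_cases h2 : H.count (e, true) + H.count (e, false) = 2
    · exact hq.two e _ _ h2
    · exact (hq.other e _ _ (by omega) h2).trans (mul_le_of_le_one_right hε hθ1)
  · rw [List.mem_toFinset, ← List.count_pos_iff, hcount] at he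
    have h1 : H.count (e, true) = 0 := by omega
    have h2 : H.count (e, false) = 0 := by omega
    simp [h1, h2, hq.zero]

/-- Telescoping: the factors are replaced by `ε` one at a time. -/
theorem norm_prod_sub_pow_le {ι : Type*} [DecidableEq ι] {ε θ : ℝ} (hε : 0 ≤ ε)
    (s : Finset ι) (z : ι → ℂ) (h1 : ∀ i ∈ s, ‖z i‖ ≤ ε) (h2 : ∀ i ∈ s, ‖z i - ε‖ ≤ ε * θ) :
    ‖∏ i ∈ s, z i - (ε : ℂ) ^ s.card‖ ≤ s.card * θ * ε ^ s.card := by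
  induction s using Finset.induction_on with
  | empty => simp
  | insert i s hi ih =>
    rw [Finset.prod_insert hi, Finset.card_insert_of_notMem hi]
    have ih' := ih (fun j hj => h1 j (Finset.mem_insert_of_mem hj))
      (fun j hj => h2 j (Finset.mem_insert_of_mem hj))
    have e : z i * ∏ j ∈ s, z j - (ε : ℂ) ^ (s.card + 1) =
        z i * (∏ j ∈ s, z j - (ε : ℂ) ^ s.card) + (z i - ε) * (ε : ℂ) ^ s.card := by ring
    have hi1 := h1 i (Finset.mem_insert_self _ _)
    have hi2 := h2 i (Finset.mem_insert_self _ _)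
    rw [e]
    refine (norm_add_le _ _).trans ?_
    rw [norm_mul, norm_mul, norm_pow, Complex.norm_real, Real.norm_of_nonneg hε]
    calc _ ≤ ε * (s.card * θ * ε ^ s.card) + ε * θ * ε ^ s.card := by gcongr
      _ = _ := by push_cast; ring

/-- Only the absolute second moments `q e 1 1` occur on tree walks; `E X_e ^ 2`, about which nothing
is assumed for complex entries, never appears. -/
theorem pathMoment_of_perm (hq : IsMomentTable ε θ q) {H : List ((V × V) × Bool)}
    {C : List (V × V)} (hC : C.Nodup)
    (hH : H.Perm (C.map (fun e => (e, true)) ++ C.map (fun e => (e, false)))) :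
    pathMoment q H = ∏ e ∈ C.toFinset, q e 1 1 := by
  have hcount : ∀ (e : V × V) (b : Bool), H.count (e, b) = C.count e := by
    intro e b
    rw [hH.count_eq, List.count_append]
    have h1 : ∀ b : Bool, (C.map fun e => (e, b)).count (e, b) = C.count e := fun b =>
      List.count_map_of_injective C _ (fun x y h => (Prod.mk.inj h).1) e
    have h2 : ∀ b : Bool, (C.map fun e => (e, !b)).count (e, b) = 0 := fun b => by
      rw [List.count_eq_zero]
      simp
    cases b
    · rw [h1 false]
      have := h2 false
      simp only [Bool.not_false] at this
      omega
    · rw [h1 true]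
      have := h2 true
      simp only [Bool.not_true] at this
      omega
  rw [pathMoment, ← Finset.prod_subset (Finset.subset_univ C.toFinset)]
  · refine Finset.prod_congr rfl fun e he => ?_
    rw [hcount, hcount, List.count_eq_one_of_mem hC (List.mem_toFinset.1 he)]
  · intro e _ he
    rw [hcount, hcount, List.count_eq_zero_of_not_mem (fun h => he (List.mem_toFinset.2 h)),
      hq.zero]

-- The factor `ε` is the normalisation of the trace. It turns `ε ^ (number of edges)` into `ε ^
-- (number of vertices)` for walks with one more vertex than edges, and every error is measured
-- against this last power.
open Classical in
theorem norm_pathMoment_sub_le (hq : IsMomentTable ε θ q) (hε : 0 ≤ ε) (hε1 : ε ≤ 1) (hθ : 0 ≤ θ)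
    (hθ1 : θ ≤ 1) (w : List Bool) (r : V) (l : List V) (hl : l.length = w.length) :
    ‖ε * (if l.getLastD r = r then pathMoment q (walkSteps w r l) else 0) -
        ((if IsTreeWalk {r} [] r w l then ε ^ ({r} ∪ l.toFinset).card else 0 : ℝ) : ℂ)‖ ≤
      (w.length + 1) * (θ + ε) * ε ^ ({r} ∪ l.toFinset).card := by
  have hL : (1 : ℝ) ≤ w.length + 1 := by
    have : (0 : ℝ) ≤ w.length := Nat.cast_nonneg _
    linarith
  by_cases hw : IsTreeWalk {r} [] r w l
  · obtain ⟨hlast, C, hC, hcard, hperm⟩ := hw.exists_perm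
    rw [if_pos hw, if_pos hlast, pathMoment_of_perm hq hC hperm, ← hcard]
    have h := norm_prod_sub_pow_le hε C.toFinset (fun e => q e 1 1)
      (fun e _ => hq.two e 1 1 rfl) (fun e _ => hq.variance e)
    rw [List.toFinset_card_of_nodup hC] at h
    have e : ε * ∏ e ∈ C.toFinset, q e 1 1 - ((ε ^ (C.length + 1) : ℝ) : ℂ) =
        ε * (∏ e ∈ C.toFinset, q e 1 1 - (ε : ℂ) ^ C.length) := by
      push_cast
      ring
    rw [e, norm_mul, Complex.norm_real, Real.norm_of_nonneg hε]
    have hCl : (C.length : ℝ) ≤ w.length + 1 := by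
      have h1 := Finset.card_union_le {r} l.toFinset
      have h2 := l.toFinset_card_le
      rw [Finset.card_singleton] at h1
      exact_mod_cast (by omega : C.length ≤ w.length + 1)
    calc ε * ‖∏ e ∈ C.toFinset, q e 1 1 - (ε : ℂ) ^ C.length‖
        ≤ ε * (C.length * θ * ε ^ C.length) := by gcongr
      _ = C.length * θ * ε ^ (C.length + 1) := by ring
      _ ≤ (w.length + 1) * (θ + ε) * ε ^ (C.length + 1) := by
          gcongr
          linarith
  · rw [if_neg hw, Complex.ofReal_zero, sub_zero, norm_mul, Complex.norm_real,
      Real.norm_of_nonneg hε]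
    have h1 : ‖(if l.getLastD r = r then pathMoment q (walkSteps w r l) else 0 : ℂ)‖ ≤
        ‖pathMoment q (walkSteps w r l)‖ := by
      split_ifs
      · exact le_rfl
      · simp
    refine (mul_le_mul_of_nonneg_left h1 hε).trans ?_
    have hpow : (0 : ℝ) ≤ ε ^ ({r} ∪ l.toFinset).card := pow_nonneg hε _
    have hfin : (θ + ε) * ε ^ ({r} ∪ l.toFinset).card ≤
        (w.length + 1) * (θ + ε) * ε ^ ({r} ∪ l.toFinset).card := by
      have : 0 ≤ (θ + ε) * ε ^ ({r} ∪ l.toFinset).card := by positivity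
      rw [mul_assoc]
      exact le_mul_of_one_le_left this hL
    refine le_trans ?_ hfin
    -- Too few vertices gains a factor `ε`; a wrong multiplicity gains a factor `θ`.
    rcases card_le_or_exists_count_ne w r l hl hw with h | ⟨h, hne⟩
    · have h2 := norm_pathMoment_le hq hε hθ1 (walkSteps w r l)
      have h3 : ε ^ ((walkSteps w r l).map Prod.fst).toFinset.card ≤
          ε ^ ({r} ∪ l.toFinset).card := pow_le_pow_of_le_one hε hε1 h
      calc _ ≤ ε * ε ^ ({r} ∪ l.toFinset).card :=
            mul_le_mul_of_nonneg_left (h2.trans h3) hε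
        _ ≤ _ := by gcongr; linarith
    · have h2 := norm_pathMoment_le_mul hq hε hθ1 (walkSteps w r l) hne
      have h3 : ε ^ (((walkSteps w r l).map Prod.fst).toFinset.card + 1) ≤
          ε ^ ({r} ∪ l.toFinset).card := pow_le_pow_of_le_one hε hε1 h
      calc _ ≤ ε * (θ * ε ^ ((walkSteps w r l).map Prod.fst).toFinset.card) :=
            mul_le_mul_of_nonneg_left h2 hε
        _ = θ * ε ^ (((walkSteps w r l).map Prod.fst).toFinset.card + 1) := by ring
        _ ≤ θ * ε ^ ({r} ∪ l.toFinset).card := by gcongr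
        _ ≤ _ := by gcongr; linarith

/-- The error per walk is summed with `sum_pow_card_le`; the choice of the starting vertex is
absorbed by one factor `ε`. -/
theorem norm_sum_pathMoment_sub_le (hq : IsMomentTable ε θ q) (hV : Fintype.card V * ε = 1)
    (hε : 0 ≤ ε) (hε1 : ε ≤ 1) (hθ : 0 ≤ θ) (hθ1 : θ ≤ 1) (w : List Bool) :
    ‖ε * ∑ r : V, ∑ v : Fin w.length → V,
        (if (List.ofFn v).getLastD r = r then pathMoment q (walkSteps w r (List.ofFn v)) else 0) -
        (stackWeight ε w 1 [] : ℂ)‖ ≤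
      (w.length + 1) * (θ + ε) * walkBound w.length 1 := by
  classical
  have h1 : (stackWeight ε w 1 [] : ℂ) = ∑ r : V, ∑ v : Fin w.length → V,
      ((if IsTreeWalk {r} [] r w (List.ofFn v) then
        ε ^ ({r} ∪ (List.ofFn v).toFinset).card else 0 : ℝ) : ℂ) := by
    have h := fun r : V => sum_isTreeWalk hV w {r} [] r (by simp) (by simp)
    simp only [← Complex.ofReal_sum, h, Finset.card_singleton, Finset.sum_const, nsmul_eq_mul,
      List.map_nil, Finset.card_univ]
    rw [pow_one, ← Complex.ofReal_natCast, ← Complex.ofReal_mul, ← mul_assoc, hV, one_mul]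
  rw [h1, Finset.mul_sum, ← Finset.sum_sub_distrib]
  have h2 : ∀ r : V, ‖ε * (∑ v : Fin w.length → V,
        (if (List.ofFn v).getLastD r = r then pathMoment q (walkSteps w r (List.ofFn v)) else 0)) -
        ∑ v : Fin w.length → V, ((if IsTreeWalk {r} [] r w (List.ofFn v) then
        ε ^ ({r} ∪ (List.ofFn v).toFinset).card else 0 : ℝ) : ℂ)‖ ≤
      (w.length + 1) * (θ + ε) * (ε * walkBound w.length 1) := by
    intro r
    rw [Finset.mul_sum, ← Finset.sum_sub_distrib]
    refine (norm_sum_le _ _).trans ?_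
    refine (Finset.sum_le_sum fun v _ => norm_pathMoment_sub_le hq hε hε1 hθ hθ1 w r
      (List.ofFn v) (by simp)).trans ?_
    rw [← Finset.mul_sum]
    have h := sum_pow_card_le hε hV w.length {r}
    rw [Finset.card_singleton, pow_one] at h
    gcongr
  refine (norm_sum_le _ _).trans ((Finset.sum_le_sum fun r _ => h2 r).trans (le_of_eq ?_))
  rw [Finset.sum_const, nsmul_eq_mul, Finset.card_univ]
  linear_combination ((w.length + 1) * (θ + ε) * walkBound w.length 1) * hV

end PathMoments

/-! ### Traces of words in a random matrix and its adjoint -/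

section WordMatrix

open scoped ComplexConjugate

variable {V : Type*}

/-- The factor contributed by a step of a walk to an entry of a product of matrices. -/
noncomputable def stepFactor (X : Matrix V V ℂ) (s : (V × V) × Bool) : ℂ :=
  if s.2 then X s.1.1 s.1.2 else conj (X s.1.1 s.1.2)

variable [Fintype V]

theorem integrable_prod_pow {Ω : Type*} [MeasurableSpace Ω] {μ : Measure Ω}
    [IsFiniteMeasure μ] {x : V → V → Ω → ℂ} (hm : ∀ i j, Measurable (x i j))
    {M : ℝ} (hM : ∀ i j ω, ‖x i j ω‖ ≤ M) (a b : V × V → ℕ) :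
    Integrable (fun ω => ∏ e : V × V, x e.1 e.2 ω ^ a e * conj (x e.1 e.2 ω) ^ b e) μ := by
  refine Integrable.of_bound (C := ∏ e : V × V, M ^ (a e + b e)) ?_
    (Eventually.of_forall fun ω => ?_)
  · refine Measurable.aestronglyMeasurable (Finset.measurable_fun_prod _ fun e _ => ?_)
    exact ((hm _ _).pow_const _).mul
      ((Complex.continuous_conj.measurable.comp (hm _ _)).pow_const _)
  · rw [norm_prod]
    refine Finset.prod_le_prod (fun _ _ => norm_nonneg _) fun e _ => ?_
    rw [norm_mul, norm_pow, norm_pow, RCLike.norm_conj, ← pow_add]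
    exact pow_le_pow_left₀ (norm_nonneg _) (hM _ _ _) _

variable [DecidableEq V]

/-- The product of copies of `X` and of its adjoint prescribed by a word. -/
def wordMatrix (X : Matrix V V ℂ) (w : List Bool) : Matrix V V ℂ :=
  (w.map fun b => if b then X else X.conjTranspose).prod

theorem wordMatrix_apply (X : Matrix V V ℂ) (w : List Bool) (r s : V) :
    wordMatrix X w r s = ∑ v : Fin w.length → V, if (List.ofFn v).getLastD r = s then
      ((walkSteps w r (List.ofFn v)).map (stepFactor X)).prod else 0 := by
  induction w generalizing r with
  | nil => simp [wordMatrix, walkSteps, Matrix.one_apply]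
  | cons b w ih =>
    rw [List.length_cons, sum_ofFn_succ w.length (fun l => if l.getLastD r = s then
      ((walkSteps (b :: w) r l).map (stepFactor X)).prod else 0)]
    have h : wordMatrix X (b :: w) = (if b then X else X.conjTranspose) * wordMatrix X w := by
      simp [wordMatrix]
    rw [h, Matrix.mul_apply]
    refine Finset.sum_congr rfl fun j _ => ?_
    rw [ih, Finset.mul_sum]
    refine Finset.sum_congr rfl fun v _ => ?_
    rw [List.getLastD_cons, walkSteps, List.map_cons, List.prod_cons]
    have hf : (if b then X else X.conjTranspose) r j = stepFactor X (stepEdge b r j, b) := by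
      cases b <;> simp [stepFactor, stepEdge, Matrix.conjTranspose_apply]
    rw [hf]
    split_ifs <;> simp

/-- Grouping equal positions makes independence applicable, since distinct positions carry
independent entries. -/
theorem prod_map_stepFactor (X : Matrix V V ℂ) (H : List ((V × V) × Bool)) :
    (H.map (stepFactor X)).prod = ∏ e : V × V,
      X e.1 e.2 ^ H.count (e, true) * conj (X e.1 e.2) ^ H.count (e, false) := by
  induction H with
  | nil => simp
  | cons x H ih =>
    obtain ⟨e, b⟩ := x
    rw [List.map_cons, List.prod_cons, ih]
    have h : ∀ e' : V × V, X e'.1 e'.2 ^ ((e, b) :: H).count (e', true) *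
        conj (X e'.1 e'.2) ^ ((e, b) :: H).count (e', false) =
        (if e' = e then stepFactor X (e, b) else 1) * (X e'.1 e'.2 ^ H.count (e', true) *
          conj (X e'.1 e'.2) ^ H.count (e', false)) := by
      intro e'
      by_cases he : e' = e
      · subst he
        cases b
        · simp [stepFactor, pow_succ]; ring
        · simp [stepFactor, pow_succ]; ring
      · have he' : e ≠ e' := fun h => he h.symm
        simp [he, he']
    simp_rw [h]
    rw [Finset.prod_mul_distrib (f := fun e' => if e' = e then stepFactor X (e, b) else 1),
      Finset.prod_ite_eq' Finset.univ e, if_pos (Finset.mem_univ _)]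

variable {Ω : Type*} [MeasurableSpace Ω] {μ : Measure Ω}

/-- The joint moments of the entries of a random matrix. -/
noncomputable def entryMoment (μ : Measure Ω) (x : V → V → Ω → ℂ) (e : V × V) (a b : ℕ) : ℂ :=
  ∫ ω, x e.1 e.2 ω ^ a * conj (x e.1 e.2 ω) ^ b ∂μ

theorem integral_prod_pow [IsProbabilityMeasure μ] {x : V → V → Ω → ℂ}
    (hm : ∀ i j, Measurable (x i j)) (hind : iIndepFun (fun ij : V × V => x ij.1 ij.2) μ)
    (H : List ((V × V) × Bool)) :
    ∫ ω, ∏ e : V × V, x e.1 e.2 ω ^ H.count (e, true) * conj (x e.1 e.2 ω) ^ H.count (e, false) ∂μ =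
      pathMoment (entryMoment μ x) H := by
  have h := hind.integral_fun_prod_comp
    (f := fun e z => z ^ H.count (e, true) * conj z ^ H.count (e, false))
    (fun e => (hm _ _).aemeasurable) (fun e => by
      have : Continuous fun z : ℂ => z ^ H.count (e, true) * conj z ^ H.count (e, false) := by
        fun_prop
      exact this.aestronglyMeasurable)
  exact h

theorem integrable_trace_wordMatrix [IsFiniteMeasure μ] {x : V → V → Ω → ℂ}
    (hm : ∀ i j, Measurable (x i j)) {M : ℝ} (hM : ∀ i j ω, ‖x i j ω‖ ≤ M) (w : List Bool) :
    Integrable (fun ω => (wordMatrix (Matrix.of fun i j => x i j ω) w).trace) μ := by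
  simp only [Matrix.trace, Matrix.diag_apply, wordMatrix_apply, prod_map_stepFactor,
    Matrix.of_apply]
  refine integrable_finsetSum _ fun r _ => integrable_finsetSum _ fun v _ => ?_
  split_ifs
  · exact integrable_prod_pow hm hM _ _
  · exact integrable_zero _ _ _

theorem integral_trace_wordMatrix [IsProbabilityMeasure μ] {x : V → V → Ω → ℂ}
    (hm : ∀ i j, Measurable (x i j)) (hind : iIndepFun (fun ij : V × V => x ij.1 ij.2) μ)
    {M : ℝ} (hM : ∀ i j ω, ‖x i j ω‖ ≤ M) (w : List Bool) :
    ∫ ω, (wordMatrix (Matrix.of fun i j => x i j ω) w).trace ∂μ =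
      ∑ r : V, ∑ v : Fin w.length → V, (if (List.ofFn v).getLastD r = r then
        pathMoment (entryMoment μ x) (walkSteps w r (List.ofFn v)) else 0) := by
  simp only [Matrix.trace, Matrix.diag_apply, wordMatrix_apply, prod_map_stepFactor,
    Matrix.of_apply]
  have hint : ∀ (r : V) (v : Fin w.length → V), Integrable (fun ω =>
      if (List.ofFn v).getLastD r = r then ∏ e : V × V,
        x e.1 e.2 ω ^ (walkSteps w r (List.ofFn v)).count (e, true) *
          conj (x e.1 e.2 ω) ^ (walkSteps w r (List.ofFn v)).count (e, false) else 0) μ := by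
    intro r v
    split_ifs
    · exact integrable_prod_pow hm hM _ _
    · exact integrable_zero _ _ _
  rw [integral_finsetSum _ fun r _ => integrable_finsetSum _ fun v _ => hint r v]
  refine Finset.sum_congr rfl fun r _ => ?_
  rw [integral_finsetSum _ fun v _ => hint r v]
  refine Finset.sum_congr rfl fun v _ => ?_
  split_ifs
  · exact integral_prod_pow hm hind _
  · simp

end WordMatrix

/-! ### Traces of block words as spectral moments -/

theorem powerMatrix_pow_eq {N : ℕ} (m p : ℕ) (X : Matrix (Fin N) (Fin N) ℂ) :
    powerMatrix m X ^ p = wordMatrix X (blockWord m p) := by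
  induction p with
  | zero => simp [blockWord, wordMatrix]
  | succ p ih =>
    rw [pow_succ', ih, blockWord_succ]
    simp [wordMatrix, powerMatrix, mul_assoc]

theorem sum_eigenvalues_pow {n : Type*} [Fintype n] [DecidableEq n] {A : Matrix n n ℂ}
    (hA : A.IsHermitian) (p : ℕ) :
    ∑ k, hA.eigenvalues k ^ p = (A ^ p).trace.re := by
  have h : (A ^ p).trace = ∑ k, ((hA.eigenvalues k : ℂ)) ^ p := by
    conv_lhs => rw [hA.spectral_theorem]
    rw [← map_pow, Unitary.conjStarAlgAut_apply, Matrix.trace_mul_cycle]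
    simp [Matrix.diagonal_pow, Matrix.trace_diagonal]
  rw [h]
  simp [← Complex.ofReal_pow]

/-! ### Truncated entries -/

section Truncation

open scoped ComplexConjugate

/-- Truncation of a complex number at level `c`. -/
noncomputable def truncate (c : ℝ) (z : ℂ) : ℂ := if ‖z‖ ≤ c then z else 0

theorem measurable_truncate (c : ℝ) : Measurable (truncate c) :=
  Measurable.ite (measurableSet_le measurable_norm measurable_const) measurable_id measurable_const

theorem norm_truncate_le_norm (c : ℝ) (z : ℂ) : ‖truncate c z‖ ≤ ‖z‖ := by
  unfold truncate
  split_ifs <;> simp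

theorem norm_truncate_le {c : ℝ} (hc : 0 ≤ c) (z : ℂ) : ‖truncate c z‖ ≤ c := by
  unfold truncate
  split_ifs with h
  · exact h
  · simpa using hc

theorem norm_sub_truncate_mul_le {c : ℝ} (hc : 0 ≤ c) (z : ℂ) :
    ‖z - truncate c z‖ * c ^ 3 ≤ ‖z‖ ^ 4 := by
  unfold truncate
  split_ifs with h
  · simp
  · rw [sub_zero]
    calc ‖z‖ * c ^ 3 ≤ ‖z‖ * ‖z‖ ^ 3 := by
          have := (not_le.1 h).le
          gcongr
      _ = _ := by ring

theorem norm_sq_sub_truncate_mul_le {c : ℝ} (hc : 0 ≤ c) (z : ℂ) :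
    (‖z‖ ^ 2 - ‖truncate c z‖ ^ 2) * c ^ 2 ≤ ‖z‖ ^ 4 := by
  unfold truncate
  split_ifs with h
  · simp
  · rw [norm_zero, zero_pow two_ne_zero, sub_zero]
    calc ‖z‖ ^ 2 * c ^ 2 ≤ ‖z‖ ^ 2 * ‖z‖ ^ 2 := by
          have := (not_le.1 h).le
          gcongr
      _ = _ := by ring

variable {Ω : Type*} [MeasurableSpace Ω] {μ : Measure Ω} [IsProbabilityMeasure μ]

/-- Moments of a truncated and normalised entry; `ρ` stands for `1 / √N`. -/
theorem moments_truncate {x : Ω → ℂ} (hx : Measurable x) (hmean : ∫ ω, x ω ∂μ = 0)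
    (hvar : ∫ ω, ‖x ω‖ ^ 2 ∂μ = 1) {B : ℝ} (hint : Integrable (fun ω => ‖x ω‖ ^ 4) μ)
    (hB : ∫ ω, ‖x ω‖ ^ 4 ∂μ ≤ B) {ρ α : ℝ} (hρ : 0 < ρ) (hα : 0 < α) (hα1 : α ≤ 1) (a b : ℕ) :
    let y : Ω → ℂ := fun ω => ρ * truncate (α * ρ⁻¹) (x ω)
    (a + b = 2 → ‖∫ ω, y ω ^ a * conj (y ω) ^ b ∂μ‖ ≤ ρ ^ 2) ∧
    (a + b ≠ 0 → a + b ≠ 2 →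
      ‖∫ ω, y ω ^ a * conj (y ω) ^ b ∂μ‖ ≤ ρ ^ 2 * (α + ρ ^ 2 * B / α ^ 3)) ∧
    ‖∫ ω, y ω ^ 1 * conj (y ω) ^ 1 ∂μ - (ρ ^ 2 : ℝ)‖ ≤ ρ ^ 2 * (α + ρ ^ 2 * B / α ^ 3) := by
  intro y
  have hc : 0 ≤ α * ρ⁻¹ := by positivity
  have hB0 : 0 ≤ B := (integral_nonneg fun ω => by positivity).trans hB
  have hty : Measurable fun ω => truncate (α * ρ⁻¹) (x ω) := (measurable_truncate _).comp hx
  -- The integral of a non-integrable function is `0` by convention, and `hvar` says that it is `1`.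
  have hint2 : Integrable (fun ω => ‖x ω‖ ^ 2) μ := by
    by_contra h
    rw [integral_undef h] at hvar
    exact zero_ne_one hvar
  have hynorm : ∀ ω, ‖y ω‖ = ρ * ‖truncate (α * ρ⁻¹) (x ω)‖ := fun ω => by
    simp only [y]
    rw [norm_mul, Complex.norm_real, Real.norm_of_nonneg hρ.le]
  have hyα : ∀ ω, ‖y ω‖ ≤ α := fun ω => by
    rw [hynorm]
    calc ρ * _ ≤ ρ * (α * ρ⁻¹) := by gcongr; exact norm_truncate_le hc _
      _ = α := by field_simp
  have hy2 : ∀ ω, ‖y ω‖ ^ 2 ≤ ρ ^ 2 * ‖x ω‖ ^ 2 := fun ω => by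
    rw [hynorm, mul_pow]
    gcongr
    exact norm_truncate_le_norm _ _
  have hnorm : ∀ ω, ‖y ω ^ a * conj (y ω) ^ b‖ = ‖y ω‖ ^ (a + b) := fun ω => by
    rw [norm_mul, norm_pow, norm_pow, RCLike.norm_conj, pow_add]
  have hbound : ∀ C : ℝ, (∀ ω, ‖y ω‖ ^ (a + b) ≤ C * ‖y ω‖ ^ 2) → 0 ≤ C →
      ‖∫ ω, y ω ^ a * conj (y ω) ^ b ∂μ‖ ≤ C * ρ ^ 2 := by
    intro C hC hC0
    have h1 : ∫ ω, C * ρ ^ 2 * ‖x ω‖ ^ 2 ∂μ = C * ρ ^ 2 := by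
      rw [integral_const_mul, hvar, mul_one]
    rw [← h1]
    refine norm_integral_le_of_norm_le (hint2.const_mul _) (Eventually.of_forall fun ω => ?_)
    rw [hnorm]
    calc _ ≤ C * ‖y ω‖ ^ 2 := hC ω
      _ ≤ C * (ρ ^ 2 * ‖x ω‖ ^ 2) := by gcongr; exact hy2 ω
      _ = _ := by ring
  have hintx : Integrable x μ := by
    refine (hint2.add (integrable_const (1 : ℝ))).mono' hx.aestronglyMeasurable
      (Eventually.of_forall fun ω => ?_)
    simp only [Pi.add_apply]
    nlinarith [sq_nonneg (‖x ω‖ - 1), norm_nonneg (x ω)]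
  have hintt : Integrable (fun ω => truncate (α * ρ⁻¹) (x ω)) μ :=
    hintx.mono hty.aestronglyMeasurable (Eventually.of_forall fun ω => norm_truncate_le_norm _ _)
  have hmean1 : ‖∫ ω, y ω ∂μ‖ ≤ ρ ^ 2 * (ρ ^ 2 * B / α ^ 3) := by
    simp only [y]
    rw [integral_const_mul, norm_mul, Complex.norm_real, Real.norm_of_nonneg hρ.le]
    -- Since `x` is centred, the mean of the truncated variable is minus that of the tail, which the
    -- fourth moment bounds. No recentring is needed.
    have h1 : ∫ ω, truncate (α * ρ⁻¹) (x ω) ∂μ = -∫ ω, (x ω - truncate (α * ρ⁻¹) (x ω)) ∂μ := by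
      rw [integral_sub hintx hintt, hmean]
      ring
    have h2 : ‖∫ ω, (x ω - truncate (α * ρ⁻¹) (x ω)) ∂μ‖ ≤ ∫ ω, (ρ / α) ^ 3 * ‖x ω‖ ^ 4 ∂μ := by
      refine norm_integral_le_of_norm_le (hint.const_mul _) (Eventually.of_forall fun ω => ?_)
      have h3 := norm_sub_truncate_mul_le hc (x ω)
      have h4 : 0 < (ρ / α) ^ 3 := by positivity
      calc _ = (ρ / α) ^ 3 * (‖x ω - truncate (α * ρ⁻¹) (x ω)‖ * (α * ρ⁻¹) ^ 3) := by field_simp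
        _ ≤ _ := by gcongr
    rw [integral_const_mul] at h2
    rw [h1, norm_neg]
    calc ρ * _ ≤ ρ * ((ρ / α) ^ 3 * B) := by
          gcongr
          exact h2.trans (by gcongr)
      _ = _ := by field_simp
  have hvar1 : ‖∫ ω, y ω ^ 1 * conj (y ω) ^ 1 ∂μ - (ρ ^ 2 : ℝ)‖ ≤
      ρ ^ 2 * (ρ ^ 2 * B / α ^ 2) := by
    have h1 : ∀ ω, y ω ^ 1 * conj (y ω) ^ 1 =
        ((ρ ^ 2 * ‖truncate (α * ρ⁻¹) (x ω)‖ ^ 2 : ℝ) : ℂ) := fun ω => by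
      rw [pow_one, pow_one, Complex.mul_conj, Complex.normSq_eq_norm_sq, hynorm, mul_pow]
    simp_rw [h1]
    rw [integral_complex_ofReal, integral_const_mul, ← Complex.ofReal_sub, Complex.norm_real]
    have hintt2 : Integrable (fun ω => ‖truncate (α * ρ⁻¹) (x ω)‖ ^ 2) μ :=
      hint2.mono (hty.norm.pow_const 2).aestronglyMeasurable (Eventually.of_forall fun ω => by
        simp only [norm_pow, norm_norm]
        gcongr
        exact norm_truncate_le_norm _ _)
    have h2 : ρ ^ 2 * ∫ ω, ‖truncate (α * ρ⁻¹) (x ω)‖ ^ 2 ∂μ - ρ ^ 2 =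
        -(ρ ^ 2 * ∫ ω, (‖x ω‖ ^ 2 - ‖truncate (α * ρ⁻¹) (x ω)‖ ^ 2) ∂μ) := by
      rw [integral_sub hint2 hintt2, hvar]
      ring
    rw [h2, norm_neg, norm_mul, Real.norm_of_nonneg (by positivity : 0 ≤ ρ ^ 2)]
    gcongr
    have h3 : ‖∫ ω, (‖x ω‖ ^ 2 - ‖truncate (α * ρ⁻¹) (x ω)‖ ^ 2) ∂μ‖ ≤
        ∫ ω, (ρ / α) ^ 2 * ‖x ω‖ ^ 4 ∂μ := by
      refine norm_integral_le_of_norm_le (hint.const_mul _) (Eventually.of_forall fun ω => ?_)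
      have h3 := norm_sq_sub_truncate_mul_le hc (x ω)
      have h4 : ‖truncate (α * ρ⁻¹) (x ω)‖ ^ 2 ≤ ‖x ω‖ ^ 2 := by
        gcongr
        exact norm_truncate_le_norm _ _
      rw [Real.norm_of_nonneg (by linarith)]
      calc _ = (ρ / α) ^ 2 * ((‖x ω‖ ^ 2 - ‖truncate (α * ρ⁻¹) (x ω)‖ ^ 2) * (α * ρ⁻¹) ^ 2) := by
            field_simp
        _ ≤ _ := by gcongr
    rw [integral_const_mul] at h3
    calc _ ≤ _ := h3
      _ ≤ (ρ / α) ^ 2 * B := by gcongr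
      _ = _ := by field_simp
  refine ⟨fun h => ?_, fun h0 h2 => ?_, hvar1.trans ?_⟩
  · have := hbound 1 (fun ω => by rw [h, one_mul]) zero_le_one
    rwa [one_mul] at this
  · by_cases h1 : a + b = 1
    · have e1 : ‖∫ ω, y ω ^ a * conj (y ω) ^ b ∂μ‖ = ‖∫ ω, y ω ∂μ‖ := by
        obtain ⟨rfl, rfl⟩ | ⟨rfl, rfl⟩ : (a = 1 ∧ b = 0) ∨ (a = 0 ∧ b = 1) := by omega
        · simp
        · simp only [pow_zero, pow_one, one_mul]
          rw [integral_conj, RCLike.norm_conj]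
      rw [e1]
      refine hmean1.trans ?_
      gcongr
      linarith
    · have h3 := hbound α (fun ω => by
        obtain ⟨k, hk⟩ : ∃ k, a + b = k + 3 := ⟨a + b - 3, by omega⟩
        rw [hk]
        calc ‖y ω‖ ^ (k + 3) = ‖y ω‖ ^ k * ‖y ω‖ * ‖y ω‖ ^ 2 := by ring
          _ ≤ 1 * α * ‖y ω‖ ^ 2 := by
            gcongr
            · exact pow_le_one₀ (norm_nonneg _) ((hyα ω).trans hα1)
            · exact hyα ω
          _ = _ := by ring) hα.le
      refine h3.trans ?_
      rw [mul_comm]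
      gcongr
      have : 0 ≤ ρ ^ 2 * B / α ^ 3 := by positivity
      linarith
  · gcongr
    -- As `α ≤ 1`, the variance error is also covered by the larger bound that comes from the mean.
    calc ρ ^ 2 * B / α ^ 2 ≤ ρ ^ 2 * B / α ^ 3 := by
          exact div_le_div_of_nonneg_left (by positivity) (by positivity)
            (pow_le_pow_of_le_one hα.le hα1 (by norm_num))
      _ ≤ _ := by linarith

end Truncation

/-! ### The limit law as a product of independent beta variables -/

section LimitLaw

theorem beta_add_one {a b : ℝ} (ha : 0 < a) (hb : 0 < b) :
    beta (a + 1) b = a / (a + b) * beta a b := by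
  have h : a + 1 + b = a + b + 1 := by ring
  have h1 := (Real.Gamma_pos_of_pos (add_pos ha hb)).ne'
  rw [beta, beta, h, Real.Gamma_add_one ha.ne', Real.Gamma_add_one (add_pos ha hb).ne']
  have h2 := (add_pos ha hb).ne'
  field_simp

theorem beta_add_nat {a b : ℝ} (ha : 0 < a) (hb : 0 < b) (p : ℕ) :
    beta (a + p) b = (∏ i ∈ Finset.range p, (a + i) / (a + b + i)) * beta a b := by
  induction p with
  | zero => simp
  | succ p ih =>
    rw [Nat.cast_succ, ← add_assoc, beta_add_one (by positivity) hb, ih, Finset.prod_range_succ]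
    have : a + p + b = a + b + p := by ring
    rw [this]
    ring

theorem betaPDFReal_nonneg {a b : ℝ} (ha : 0 < a) (hb : 0 < b) (x : ℝ) : 0 ≤ betaPDFReal a b x := by
  by_cases hx : 0 < x ∧ x < 1
  · exact (betaPDFReal_pos hx.1 hx.2 ha hb).le
  · rw [betaPDFReal, if_neg hx]

/-- Multiplication by `x ^ p` shifts the first beta parameter, so a moment is a quotient of two
normalising constants. -/
theorem betaPDFReal_mul_pow {a b : ℝ} (ha : 0 < a) (hb : 0 < b) (p : ℕ) (x : ℝ) :
    betaPDFReal a b x * x ^ p = beta (a + p) b / beta a b * betaPDFReal (a + p) b x := by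
  by_cases hx : 0 < x ∧ x < 1
  · rw [betaPDFReal, betaPDFReal, if_pos hx, if_pos hx]
    have h1 := (beta_pos ha hb).ne'
    have h2 := (beta_pos (by positivity : 0 < a + p) hb).ne'
    have h3 : x ^ (a + p - 1) = x ^ (a - 1) * x ^ p := by
      rw [← Real.rpow_natCast x p, ← Real.rpow_add hx.1]
      ring_nf
    rw [h3]
    field_simp
  · rw [betaPDFReal, betaPDFReal, if_neg hx, if_neg hx]
    ring

theorem integral_betaPDFReal {a b : ℝ} (ha : 0 < a) (hb : 0 < b) :
    ∫ x, betaPDFReal a b x = 1 := by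
  rw [integral_eq_lintegral_of_nonneg_ae (Eventually.of_forall (betaPDFReal_nonneg ha hb))
    (measurable_betaPDFReal a b).aestronglyMeasurable]
  have := lintegral_betaPDF_eq_one ha hb
  simp only [betaPDF] at this
  rw [this, ENNReal.toReal_one]

theorem integral_pow_betaMeasure {a b : ℝ} (ha : 0 < a) (hb : 0 < b) (p : ℕ) :
    ∫ x, x ^ p ∂betaMeasure a b = ∏ i ∈ Finset.range p, (a + i) / (a + b + i) := by
  have h : betaMeasure a b = volume.withDensity fun x => ENNReal.ofReal (betaPDFReal a b x) := rfl
  rw [h, integral_withDensity_eq_integral_toReal_smul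
    (measurable_betaPDFReal a b).ennreal_ofReal
    (Eventually.of_forall fun _ => ENNReal.ofReal_lt_top)]
  simp only [ENNReal.toReal_ofReal (betaPDFReal_nonneg ha hb _), smul_eq_mul,
    betaPDFReal_mul_pow ha hb]
  rw [integral_const_mul, integral_betaPDFReal (by positivity) hb, mul_one, beta_add_nat ha hb,
    mul_div_assoc, div_self (beta_pos ha hb).ne', mul_one]

theorem betaMeasure_ae_mem {a b : ℝ} : ∀ᵐ x ∂betaMeasure a b, x ∈ Set.Icc (0 : ℝ) 1 := by
  have hm : Measurable (betaPDF a b) := (measurable_betaPDFReal a b).ennreal_ofReal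
  rw [betaMeasure, ae_withDensity_iff hm]
  refine Eventually.of_forall fun x hx => ?_
  by_contra h
  apply hx
  rcases not_and_or.1 h with h | h
  · exact betaPDF_eq_zero_of_nonpos (not_le.1 h).le
  · exact betaPDF_eq_zero_of_one_le (not_le.1 h).le

theorem betaMeasure_singleton (a b t : ℝ) : betaMeasure a b {t} = 0 :=
  withDensity_absolutelyContinuous _ _ (by simp)

/-- For fixed `x ≠ 0` the equation `x * y = t` leaves one value of `y`, which is null for `ν`;
Fubini does the rest. The factor `μ` may have atoms away from `0`. -/
theorem mconv_singleton {μ ν : Measure ℝ} [SFinite ν] (hμ : μ {0} = 0) (hν : ∀ t, ν {t} = 0)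
    (t : ℝ) : (μ.mconv ν) {t} = 0 := by
  have hm : Measurable fun p : ℝ × ℝ => p.1 * p.2 := measurable_mul
  rw [Measure.mconv, Measure.map_apply hm (measurableSet_singleton t),
    Measure.prod_apply (hm (measurableSet_singleton t)), lintegral_eq_zero_iff
    (measurable_measure_prodMk_left (hm (measurableSet_singleton t)))]
  have h0 : ∀ᵐ x ∂μ, x ≠ 0 := by
    rw [ae_iff]
    simpa using hμ
  filter_upwards [h0] with x hx
  refine measure_mono_null (fun y hy => ?_) (hν (t / x))
  simp only [Set.mem_preimage, Set.mem_singleton_iff] at hy ⊢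
  rw [← hy]
  field_simp

/-- A multiplicative convolution of beta laws, scaled by `K`. -/
theorem exists_beta_product_law {K : ℝ} (hK : 0 < K) (a b : ℕ → ℝ) (n : ℕ)
    (ha : ∀ l < n, 0 < a l) (hb : ∀ l < n, 0 < b l) :
    ∃ ν : Measure ℝ, IsProbabilityMeasure ν ∧ (∀ᵐ x ∂ν, x ∈ Set.Icc 0 K) ∧ ν {0} = 0 ∧
      (n ≠ 0 → ∀ t, ν {t} = 0) ∧
      ∀ p : ℕ, ∫ x, x ^ p ∂ν =
        K ^ p * ∏ l ∈ Finset.range n, ∏ i ∈ Finset.range p, (a l + i) / (a l + b l + i) := by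
  induction n with
  | zero =>
    -- The empty product is an atom at `K`, so the induction carries `ν {0} = 0` separately; one
    -- beta factor then removes all atoms.
    refine ⟨Measure.dirac K, inferInstance, ?_, ?_, by simp, by simp⟩
    · rw [ae_dirac_eq]
      exact ⟨hK.le, le_rfl⟩
    · rw [Measure.dirac_apply' _ (measurableSet_singleton 0)]
      simp [hK.ne]
  | succ n ih =>
    obtain ⟨ν, hν, hsupp, h0, -, hmom⟩ := ih (fun l hl => ha l (by omega))
      (fun l hl => hb l (by omega))
    have han := ha n (by omega)
    have hbn := hb n (by omega)
    have hβ := isProbabilityMeasureBeta han hbn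
    have hsing := mconv_singleton h0 (betaMeasure_singleton (a n) (b n))
    refine ⟨ν.mconv (betaMeasure (a n) (b n)), inferInstance, ?_, hsing 0, fun _ => hsing, ?_⟩
    · rw [Measure.mconv]
      refine (ae_map_iff (p := fun x => x ∈ Set.Icc 0 K) measurable_mul.aemeasurable
        measurableSet_Icc).2 ?_
      have h1 : ∀ᵐ z ∂(ν.prod (betaMeasure (a n) (b n))), z.1 ∈ Set.Icc 0 K :=
        Measure.quasiMeasurePreserving_fst.ae hsupp
      have h2 : ∀ᵐ z ∂(ν.prod (betaMeasure (a n) (b n))), z.2 ∈ Set.Icc (0 : ℝ) 1 :=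
        Measure.quasiMeasurePreserving_snd.ae betaMeasure_ae_mem
      filter_upwards [h1, h2] with z hz1 hz2
      exact ⟨mul_nonneg hz1.1 hz2.1,
        (mul_le_of_le_one_right hz1.1 hz2.2).trans hz1.2⟩
    · intro p
      rw [Measure.mconv, integral_map measurable_mul.aemeasurable
        (by fun_prop : Continuous fun x : ℝ => x ^ p).aestronglyMeasurable]
      simp only [mul_pow]
      rw [integral_prod_mul (fun x : ℝ => x ^ p) (fun x : ℝ => x ^ p), hmom,
        integral_pow_betaMeasure han hbn, Finset.prod_range_succ, mul_assoc]

/-- The Fuss–Catalan number is `(mp+p)! / (p! (mp+1)!)`. Passing to `p + 1` multiplies the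
factorials by rising products, and the last factor `(m+1)(p+1)` of the numerator cancels against `p
+ 1`. -/
theorem fussCatalan_succ (m p : ℕ) :
    1 / ((m : ℝ) * ((p + 1 : ℕ) : ℝ) + 1) * (Nat.choose (m * (p + 1) + (p + 1)) (p + 1) : ℝ) =
      (m + 1) * (∏ l ∈ Finset.range m, (((m : ℝ) + 1) * p + (l + 1)) / (m * p + (l + 2))) *
        (1 / ((m : ℝ) * (p : ℝ) + 1) * (Nat.choose (m * p + p) p : ℝ)) := by
  have key : ∀ q : ℕ, 1 / ((m : ℝ) * (q : ℝ) + 1) * (Nat.choose (m * q + q) q : ℝ) =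
      (m * q + q).factorial / (q.factorial * (m * q + 1).factorial) := by
    intro q
    rw [Nat.cast_choose ℝ (by omega : q ≤ m * q + q), Nat.add_sub_cancel, Nat.factorial_succ]
    push_cast
    have h1 : (q.factorial : ℝ) ≠ 0 := by positivity
    have h2 : ((m * q).factorial : ℝ) ≠ 0 := by positivity
    have h3 : (m : ℝ) * q + 1 ≠ 0 := by positivity
    field_simp
  have asc : ∀ n k : ℕ, ((n + k).factorial : ℝ) =
      n.factorial * ∏ l ∈ Finset.range k, ((n : ℝ) + (l + 1)) := by
    intro n k
    induction k with
    | zero => simp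
    | succ k ih =>
      rw [← add_assoc, Nat.factorial_succ, Finset.prod_range_succ, ← mul_assoc, ← ih]
      push_cast
      ring
  rw [key, key, Finset.prod_div_distrib]
  have e1 : m * (p + 1) + (p + 1) = (m * p + p) + (m + 1) := by ring
  have e2 : m * (p + 1) + 1 = (m * p + 1) + m := by ring
  rw [e1, e2, asc (m * p + p) (m + 1), asc (m * p + 1) m, Finset.prod_range_succ,
    Nat.factorial_succ p]
  have h1 : ∏ l ∈ Finset.range m, (((m * p + p : ℕ) : ℝ) + (l + 1)) =
      ∏ l ∈ Finset.range m, (((m : ℝ) + 1) * p + (l + 1)) :=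
    Finset.prod_congr rfl fun l _ => by push_cast; ring
  have h2 : ∏ l ∈ Finset.range m, (((m * p + 1 : ℕ) : ℝ) + (l + 1)) =
      ∏ l ∈ Finset.range m, ((m : ℝ) * p + (l + 2)) :=
    Finset.prod_congr rfl fun l _ => by push_cast; ring
  rw [h1, h2]
  have h3 : ∏ l ∈ Finset.range m, ((m : ℝ) * p + (l + 2)) ≠ 0 :=
    Finset.prod_ne_zero_iff.2 fun l _ => by positivity
  have h4 : (p.factorial : ℝ) ≠ 0 := by positivity
  have h5 : ((m * p + 1).factorial : ℝ) ≠ 0 := by positivity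
  have h6 : (p : ℝ) + 1 ≠ 0 := by positivity
  push_cast
  field_simp

/-- Ratios of consecutive moments agree: clearing the denominators `m + 1` and `m` produces
`(m/(m+1))^m`, and the scale is chosen so that its product with this is `m + 1`. -/
theorem prod_pochhammer_eq_fussCatalan {m : ℕ} (hm : 1 ≤ m) (p : ℕ) :
    (((m : ℝ) + 1) ^ (m + 1) / (m : ℝ) ^ m) ^ p *
      ∏ l ∈ Finset.range m, ∏ i ∈ Finset.range p,
        (((l : ℝ) + 1) / (m + 1) + i) / (((l : ℝ) + 2) / m + i) =
      1 / ((m : ℝ) * (p : ℝ) + 1) * (Nat.choose (m * p + p) p : ℝ) := by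
  induction p with
  | zero => simp
  | succ p ih =>
    rw [fussCatalan_succ, ← ih]
    simp only [Finset.prod_range_succ, Finset.prod_mul_distrib, pow_succ]
    have hm0 : (m : ℝ) ≠ 0 := by positivity
    have h : ∏ l ∈ Finset.range m, (((l : ℝ) + 1) / (m + 1) + p) / (((l : ℝ) + 2) / m + p) =
        ((m : ℝ) / (m + 1)) ^ m *
          ∏ l ∈ Finset.range m, (((m : ℝ) + 1) * p + (l + 1)) / (m * p + (l + 2)) := by
      have hc : ((m : ℝ) / (m + 1)) ^ m = ∏ _l ∈ Finset.range m, ((m : ℝ) / (m + 1)) := by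
        rw [Finset.prod_const, Finset.card_range]
      rw [hc, ← Finset.prod_mul_distrib]
      refine Finset.prod_congr rfl fun l _ => ?_
      have h1 : (m : ℝ) * p + (l + 2) ≠ 0 := by positivity
      have h2 : ((l : ℝ) + 2) / m + p ≠ 0 := by positivity
      have h3 : (l : ℝ) + 2 + m * p ≠ 0 := by positivity
      have h4 : (m : ℝ) + 1 ≠ 0 := by positivity
      field_simp
      ring
    rw [h, div_pow (m : ℝ) ((m : ℝ) + 1) m]
    have h4 : (m : ℝ) + 1 ≠ 0 := by positivity
    field_simp

/-- The Fuss–Catalan law: compactly supported, without atoms. -/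
theorem exists_fussCatalan_law {m : ℕ} (hm : 1 ≤ m) :
    ∃ ν : Measure ℝ, IsProbabilityMeasure ν ∧ (∃ K : ℝ, 0 < K ∧ ∀ᵐ x ∂ν, x ∈ Set.Icc 0 K) ∧
      (∀ t, ν {t} = 0) ∧
      ∀ p : ℕ, ∫ x, x ^ p ∂ν =
        1 / ((m : ℝ) * (p : ℝ) + 1) * (Nat.choose (m * p + p) p : ℝ) := by
  have hm0 : (0 : ℝ) < m := by positivity
  have hK : 0 < ((m : ℝ) + 1) ^ (m + 1) / (m : ℝ) ^ m := by positivity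
  obtain ⟨ν, hν, hsupp, -, hat, hmom⟩ := exists_beta_product_law hK
    (fun l => ((l : ℝ) + 1) / (m + 1)) (fun l => ((l : ℝ) + 2) / m - ((l : ℝ) + 1) / (m + 1)) m
    (fun l _ => by positivity) (fun l _ => by
      rw [sub_pos, div_lt_div_iff₀ (by positivity) hm0]
      nlinarith [(Nat.cast_nonneg l : (0 : ℝ) ≤ l)])
  refine ⟨ν, hν, ⟨_, hK, hsupp⟩, hat (by omega), fun p => ?_⟩
  rw [hmom, ← prod_pochhammer_eq_fussCatalan hm]
  simp

end LimitLaw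

/-! ### The method of moments -/

section MethodOfMoments

/-- Where `|x|/L ≥ 1`, every even power of order at least the degree dominates. The constant `C`
does not depend on `q`, so `q` can be taken large afterwards. -/
theorem Polynomial.exists_abs_eval_le_mul_pow (P : Polynomial ℝ) {L : ℝ} (hL : 1 ≤ L) :
    ∃ C : ℝ, 0 ≤ C ∧ ∃ d : ℕ, ∀ q ≥ d, ∀ x : ℝ, L ≤ |x| → |P.eval x| ≤ C * (x / L) ^ (2 * q) := by
  have hL0 : 0 < L := by linarith
  refine ⟨∑ i ∈ Finset.range (P.natDegree + 1), |P.coeff i| * L ^ i,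
    Finset.sum_nonneg fun i _ => by positivity, P.natDegree, fun q hq x hx => ?_⟩
  rw [Polynomial.eval_eq_sum_range, Finset.sum_mul]
  refine (Finset.abs_sum_le_sum_abs _ _).trans (Finset.sum_le_sum fun i hi => ?_)
  have hxL : 1 ≤ |x| / L := by rwa [le_div_iff₀ hL0, one_mul]
  rw [abs_mul, abs_pow, mul_assoc]
  gcongr
  have h1 : (x / L) ^ (2 * q) = (|x| / L) ^ (2 * q) := by
    rw [pow_mul, pow_mul, div_pow, div_pow |x|, sq_abs]
  rw [h1]
  calc |x| ^ i = L ^ i * (|x| / L) ^ i := by rw [div_pow]; field_simp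
    _ ≤ L ^ i * (|x| / L) ^ (2 * q) := by
      have := Finset.mem_range.1 hi
      exact mul_le_mul_of_nonneg_left (pow_le_pow_right₀ hxL (by omega)) (by positivity)

theorem integrable_polynomial_eval {μ : Measure ℝ} (hint : ∀ p : ℕ, Integrable (fun x => x ^ p) μ)
    (P : Polynomial ℝ) : Integrable (fun x => P.eval x) μ := by
  simp only [Polynomial.eval_eq_sum_range]
  exact integrable_finsetSum _ fun i _ => (hint i).const_mul _

theorem integral_polynomial_eval {μ : Measure ℝ} (hint : ∀ p : ℕ, Integrable (fun x => x ^ p) μ)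
    (P : Polynomial ℝ) :
    ∫ x, P.eval x ∂μ = ∑ i ∈ Finset.range (P.natDegree + 1), P.coeff i * ∫ x, x ^ i ∂μ := by
  simp only [Polynomial.eval_eq_sum_range]
  rw [integral_finsetSum _ fun i _ => (hint i).const_mul _]
  simp only [integral_const_mul]

theorem abs_integral_sub_le {μ : Measure ℝ} [IsProbabilityMeasure μ]
    (hint : ∀ p : ℕ, Integrable (fun x => x ^ p) μ) {f g : ℝ → ℝ} (hf : Integrable f μ)
    (hg : Integrable g μ) {ε D : ℝ} {q : ℕ} (h : ∀ x, |f x - g x| ≤ ε + D * x ^ q) :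
    |∫ x, f x ∂μ - ∫ x, g x ∂μ| ≤ ε + D * ∫ x, x ^ q ∂μ := by
  rw [← integral_sub hf hg]
  have h1 : ∫ x, (ε + D * x ^ q) ∂μ = ε + D * ∫ x, x ^ q ∂μ := by
    rw [integral_add (integrable_const _) ((hint q).const_mul _), integral_const_mul]
    simp
  rw [← h1]
  exact norm_integral_le_of_norm_le (f := fun x => f x - g x) (g := fun x => ε + D * x ^ q)
    ((integrable_const _).add ((hint q).const_mul _)) (Eventually.of_forall h)

theorem integrable_pow_of_ae_mem_Icc {ν : Measure ℝ} [IsFiniteMeasure ν] {K : ℝ}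
    (hsupp : ∀ᵐ x ∂ν, x ∈ Set.Icc 0 K) (p : ℕ) : Integrable (fun x => x ^ p) ν := by
  refine Integrable.of_bound (C := K ^ p)
    (by fun_prop : Continuous fun x : ℝ => x ^ p).aestronglyMeasurable ?_
  filter_upwards [hsupp] with x hx
  rw [norm_pow, Real.norm_of_nonneg hx.1]
  exact pow_le_pow_left₀ hx.1 hx.2 _

theorem integral_pow_le_of_ae_mem_Icc {ν : Measure ℝ} [IsProbabilityMeasure ν] {K : ℝ}
    (hsupp : ∀ᵐ x ∂ν, x ∈ Set.Icc 0 K) (p : ℕ) : ∫ x, x ^ p ∂ν ≤ K ^ p := by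
  have h : ∫ x, x ^ p ∂ν ≤ ∫ _x, K ^ p ∂ν := by
    refine integral_mono_ae (integrable_pow_of_ae_mem_Icc hsupp p) (integrable_const _) ?_
    filter_upwards [hsupp] with x hx
    exact pow_le_pow_left₀ hx.1 hx.2 _
  simpa using h

/-- The `μ i` need not have bounded support. On `[-(K+1), K+1]` a polynomial approximates `f`;
outside, both are dominated by a multiple of `(x/(K+1))^(2q)`. Its integral converges to one at most
of order `(K/(K+1))^(2q)`, small for large `q`. -/
theorem tendsto_integral_of_tendsto_moments {ι : Type*} {l : Filter ι} {μ : ι → Measure ℝ}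
    [∀ i, IsProbabilityMeasure (μ i)] {ν : Measure ℝ} [IsProbabilityMeasure ν] {K : ℝ}
    (hK : 0 < K) (hsupp : ∀ᵐ x ∂ν, x ∈ Set.Icc 0 K)
    (hint : ∀ i (p : ℕ), Integrable (fun x => x ^ p) (μ i))
    (hmom : ∀ p : ℕ, Tendsto (fun i => ∫ x, x ^ p ∂μ i) l (𝓝 (∫ x, x ^ p ∂ν)))
    (f : BoundedContinuousFunction ℝ ℝ) :
    Tendsto (fun i => ∫ x, f x ∂μ i) l (𝓝 (∫ x, f x ∂ν)) := by
  rw [Metric.tendsto_nhds]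
  intro δ hδ
  -- Comparing `f` with `P` costs less than `2ε` under each of `μ i` and `ν`, and comparing the
  -- integrals of `P` costs `ε`.
  obtain ⟨ε, hε, hεδ⟩ : ∃ ε : ℝ, 0 < ε ∧ 6 * ε = δ := ⟨δ / 6, by positivity, by ring⟩
  have hL1 : 1 ≤ K + 1 := by linarith
  have hL0 : 0 < K + 1 := by linarith
  obtain ⟨P, hP⟩ := exists_polynomial_near_of_continuousOn (-(K + 1)) (K + 1) f
    f.continuous.continuousOn ε hε
  obtain ⟨C₁, hC₁, d, hd⟩ := P.exists_abs_eval_le_mul_pow hL1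
  have hC : 0 ≤ ‖f‖ + C₁ := by positivity
  have hratio : K / (K + 1) < 1 := by rw [div_lt_one hL0]; linarith
  have hlim : Tendsto (fun q : ℕ => (‖f‖ + C₁) * (K / (K + 1)) ^ q) atTop (𝓝 0) := by
    simpa using (tendsto_pow_atTop_nhds_zero_of_lt_one (by positivity) hratio).const_mul (‖f‖ + C₁)
  obtain ⟨Q, hQ⟩ := eventually_atTop.1 (hlim.eventually_lt_const hε)
  obtain ⟨q, hqd, hqQ⟩ : ∃ q, d ≤ q ∧ Q ≤ 2 * q := ⟨max d Q, le_max_left _ _, by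
    have := le_max_right d Q
    omega⟩
  have hqε := hQ (2 * q) hqQ
  set D := (‖f‖ + C₁) / (K + 1) ^ (2 * q) with hD
  have hD0 : 0 ≤ D := by positivity
  have hpt : ∀ x, |f x - P.eval x| ≤ ε + D * x ^ (2 * q) := by
    intro x
    have hx0 : 0 ≤ x ^ (2 * q) := by rw [pow_mul]; positivity
    by_cases hx : |x| ≤ K + 1
    · have := hP x (abs_le.1 hx)
      rw [abs_sub_comm] at this
      have h2 : 0 ≤ D * x ^ (2 * q) := by positivity
      linarith
    · have hx' := (not_le.1 hx).le
      have h1 := hd q hqd x hx'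
      have h2 : 1 ≤ (x / (K + 1)) ^ (2 * q) := by
        have h3 : (x / (K + 1)) ^ (2 * q) = (|x| / (K + 1)) ^ (2 * q) := by
          rw [pow_mul, pow_mul, div_pow, div_pow |x|, sq_abs]
        rw [h3]
        exact one_le_pow₀ (by rwa [le_div_iff₀ hL0, one_mul])
      have h4 : |f x| ≤ ‖f‖ * (x / (K + 1)) ^ (2 * q) :=
        (f.norm_coe_le_norm x).trans (le_mul_of_one_le_right (norm_nonneg _) h2)
      calc |f x - P.eval x| ≤ |f x| + |P.eval x| := abs_sub _ _
        _ ≤ (‖f‖ + C₁) * (x / (K + 1)) ^ (2 * q) := by linarith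
        _ = D * x ^ (2 * q) := by rw [hD, div_pow]; ring
        _ ≤ _ := by linarith
  have hintν := integrable_pow_of_ae_mem_Icc hsupp
  have hDν : D * ∫ x, x ^ (2 * q) ∂ν < ε := by
    calc D * ∫ x, x ^ (2 * q) ∂ν ≤ D * K ^ (2 * q) := by
          gcongr
          exact integral_pow_le_of_ae_mem_Icc hsupp _
      _ = (‖f‖ + C₁) * (K / (K + 1)) ^ (2 * q) := by rw [hD, div_pow]; ring
      _ < ε := hqε
  have hν := abs_integral_sub_le hintν (f.integrable ν) (integrable_polynomial_eval hintν P) hpt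
  have hPlim : Tendsto (fun i => ∫ x, P.eval x ∂μ i) l (𝓝 (∫ x, P.eval x ∂ν)) := by
    simp only [integral_polynomial_eval hintν, fun i => integral_polynomial_eval (hint i) P]
    exact tendsto_finsetSum _ fun j _ => (hmom j).const_mul _
  have hDlim : Tendsto (fun i => D * ∫ x, x ^ (2 * q) ∂μ i) l (𝓝 (D * ∫ x, x ^ (2 * q) ∂ν)) :=
    (hmom (2 * q)).const_mul D
  filter_upwards [hDlim.eventually_lt_const hDν, Metric.tendsto_nhds.1 hPlim ε hε] with i hi1 hi2
  have hi := abs_integral_sub_le (hint i) (f.integrable (μ i))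
    (integrable_polynomial_eval (hint i) P) hpt
  rw [Real.dist_eq] at hi2 ⊢
  rw [abs_le] at hi hν
  rw [abs_lt] at hi2 ⊢
  constructor <;> linarith [hi.1, hi.2, hν.1, hν.2, hi2.1, hi2.2]

/-- Portmanteau: the frontier `{t}` of the half-line is null for `ν`, whatever `t` is. -/
theorem tendsto_measureReal_Iic_of_tendsto_moments {ι : Type*} {l : Filter ι} {μ : ι → Measure ℝ}
    [∀ i, IsProbabilityMeasure (μ i)] {ν : Measure ℝ} [IsProbabilityMeasure ν] {K : ℝ}
    (hK : 0 < K) (hsupp : ∀ᵐ x ∂ν, x ∈ Set.Icc 0 K) (hat : ∀ t, ν {t} = 0)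
    (hint : ∀ i (p : ℕ), Integrable (fun x => x ^ p) (μ i))
    (hmom : ∀ p : ℕ, Tendsto (fun i => ∫ x, x ^ p ∂μ i) l (𝓝 (∫ x, x ^ p ∂ν))) (t : ℝ) :
    Tendsto (fun i => (μ i).real (Set.Iic t)) l (𝓝 (ν.real (Set.Iic t))) := by
  let μ' : ι → ProbabilityMeasure ℝ := fun i => ⟨μ i, inferInstance⟩
  let ν' : ProbabilityMeasure ℝ := ⟨ν, inferInstance⟩
  have h : Tendsto μ' l (𝓝 ν') :=
    ProbabilityMeasure.tendsto_iff_forall_integral_tendsto.2 fun f =>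
      tendsto_integral_of_tendsto_moments hK hsupp hint hmom f
  have h2 := ProbabilityMeasure.tendsto_measure_of_null_frontier_of_tendsto' h
    (E := Set.Iic t) (by
      rw [frontier_Iic]
      exact hat t)
  exact (ENNReal.tendsto_toReal (measure_ne_top ν _)).comp h2

end MethodOfMoments

/-! ### The expected spectral distribution as a measure -/

section SpectralMeasure

variable {Ω : Type*} [MeasurableSpace Ω] {N : ℕ} {A : Ω → Matrix (Fin N) (Fin N) ℂ}

theorem measurable_matrix_mul {A B : Ω → Matrix (Fin N) (Fin N) ℂ}
    (hA : ∀ i j, Measurable fun ω => A ω i j) (hB : ∀ i j, Measurable fun ω => B ω i j)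
    (i j : Fin N) : Measurable fun ω => (A ω * B ω) i j := by
  simp only [Matrix.mul_apply]
  exact Finset.measurable_fun_sum _ fun k _ => (hA i k).mul (hB k j)

theorem measurable_matrix_pow (hm : ∀ i j, Measurable fun ω => A ω i j) (p : ℕ) (i j : Fin N) :
    Measurable fun ω => (A ω ^ p) i j := by
  induction p generalizing i j with
  | zero => simp
  | succ p ih =>
    simp only [pow_succ]
    exact measurable_matrix_mul ih hm i j

theorem measurable_sum_eigenvalues_pow (hA : ∀ ω, (A ω).IsHermitian)
    (hm : ∀ i j, Measurable fun ω => A ω i j) (p : ℕ) :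
    Measurable fun ω => ∑ k, (hA ω).eigenvalues k ^ p := by
  simp only [sum_eigenvalues_pow, Matrix.trace, Matrix.diag_apply]
  exact Complex.measurable_re.comp
    (Finset.measurable_fun_sum _ fun k _ => measurable_matrix_pow hm p k k)

/-- Power sums of eigenvalues are traces of powers, hence measurable. Polynomials converging
pointwise to `f` transfer this without any measurability of single eigenvalues. -/
theorem measurable_sum_eigenvalues_continuous (hA : ∀ ω, (A ω).IsHermitian)
    (hm : ∀ i j, Measurable fun ω => A ω i j) {f : ℝ → ℝ} (hf : Continuous f) :
    Measurable fun ω => ∑ k, f ((hA ω).eigenvalues k) := by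
  have h : ∀ n : ℕ, ∃ P : Polynomial ℝ, ∀ x ∈ Set.Icc (-(n : ℝ)) n,
      |P.eval x - f x| < 1 / ((n : ℝ) + 1) := fun n =>
    exists_polynomial_near_of_continuousOn _ _ f hf.continuousOn _ (by positivity)
  choose P hP using h
  have hpt : ∀ x, Tendsto (fun n => (P n).eval x) atTop (𝓝 (f x)) := by
    intro x
    rw [tendsto_iff_norm_sub_tendsto_zero]
    refine squeeze_zero' (Eventually.of_forall fun _ => norm_nonneg _) ?_
      tendsto_one_div_add_atTop_nhds_zero_nat
    filter_upwards [tendsto_natCast_atTop_atTop.eventually_ge_atTop |x|] with n hn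
    exact (hP n x (abs_le.1 hn)).le
  refine measurable_of_tendsto_metrizable (f := fun n ω => ∑ k, (P n).eval ((hA ω).eigenvalues k))
    (fun n => ?_) (tendsto_pi_nhds.2 fun ω => tendsto_finsetSum _ fun k _ => hpt _)
  simp only [Polynomial.eval_eq_sum_range]
  simp_rw [Finset.sum_comm (s := Finset.univ), ← Finset.mul_sum]
  exact Finset.measurable_fun_sum _ fun i _ =>
    (measurable_sum_eigenvalues_pow hA hm i).const_mul _

theorem measurable_empiricalSpectralDistribution (hA : ∀ ω, (A ω).IsHermitian)
    (hm : ∀ i j, Measurable fun ω => A ω i j) (t : ℝ) :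
    Measurable fun ω => empiricalSpectralDistribution (hA ω) t := by
  refine Measurable.const_mul ?_ _
  -- The indicator of the half-line is a pointwise limit of continuous functions equal to `1` up to
  -- `t` and to powers of a number below `1` beyond it.
  have hpt : ∀ x : ℝ, Tendsto (fun n : ℕ => ((1 + max 0 (x - t))⁻¹) ^ n) atTop
      (𝓝 (Set.indicator {s : ℝ | s ≤ t} (fun _ => (1 : ℝ)) x)) := by
    intro x
    by_cases hx : x ≤ t
    · have h0 : max 0 (x - t) = 0 := max_eq_left (by linarith)
      simp [Set.indicator, hx]
    · have h0 : 0 < max 0 (x - t) := lt_max_of_lt_right (by linarith)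
      rw [Set.indicator_of_notMem (by simpa using hx)]
      exact tendsto_pow_atTop_nhds_zero_of_lt_one (by positivity)
        (inv_lt_one_of_one_lt₀ (by linarith))
  refine measurable_of_tendsto_metrizable
    (f := fun n ω => ∑ k, ((1 + max 0 ((hA ω).eigenvalues k - t))⁻¹) ^ n)
    (fun n => ?_) (tendsto_pi_nhds.2 fun ω => tendsto_finsetSum _ fun k _ => hpt _)
  refine measurable_sum_eigenvalues_continuous hA hm
    (f := fun x => ((1 + max 0 (x - t))⁻¹) ^ n) ?_
  refine Continuous.pow (Continuous.inv₀ (by fun_prop) fun x => ?_) n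
  have : 0 ≤ max 0 (x - t) := le_max_left _ _
  positivity

/-- The empirical spectral measure of a Hermitian matrix. -/
noncomputable def spectralMeasure {B : Matrix (Fin N) (Fin N) ℂ} (hB : B.IsHermitian) :
    Measure ℝ :=
  (N : ENNReal)⁻¹ • ∑ k, Measure.dirac (hB.eigenvalues k)

theorem isProbabilityMeasure_spectralMeasure (hN : N ≠ 0) {B : Matrix (Fin N) (Fin N) ℂ}
    (hB : B.IsHermitian) : IsProbabilityMeasure (spectralMeasure hB) := by
  constructor
  simp only [spectralMeasure, Measure.smul_apply, Measure.finsetSum_apply, measure_univ,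
    Finset.sum_const, Finset.card_univ, Fintype.card_fin, smul_eq_mul, nsmul_eq_mul, mul_one]
  exact ENNReal.inv_mul_cancel (by exact_mod_cast hN) (ENNReal.natCast_ne_top N)

theorem spectralMeasure_Iic (hN : N ≠ 0) {B : Matrix (Fin N) (Fin N) ℂ} (hB : B.IsHermitian)
    (t : ℝ) : spectralMeasure hB (Set.Iic t) =
      ENNReal.ofReal (empiricalSpectralDistribution hB t) := by
  have hN' : (0 : ℝ) < N := by positivity
  simp only [spectralMeasure, Measure.smul_apply, Measure.finsetSum_apply, smul_eq_mul,
    empiricalSpectralDistribution]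
  rw [ENNReal.ofReal_mul (by positivity), ENNReal.ofReal_inv_of_pos hN', ENNReal.ofReal_natCast,
    ENNReal.ofReal_sum_of_nonneg fun k _ => Set.indicator_nonneg (fun _ _ => zero_le_one) _]
  congr 1
  refine Finset.sum_congr rfl fun k _ => ?_
  rw [Measure.dirac_apply' _ measurableSet_Iic]
  by_cases h : hB.eigenvalues k ≤ t <;> simp [Set.indicator, h]

theorem integral_spectralMeasure {B : Matrix (Fin N) (Fin N) ℂ} (hB : B.IsHermitian)
    (f : ℝ → ℝ) : ∫ x, f x ∂spectralMeasure hB = (N : ℝ)⁻¹ * ∑ k, f (hB.eigenvalues k) := by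
  rw [spectralMeasure, integral_smul_measure, integral_finsetSum_measure fun k _ =>
    integrable_dirac (by finiteness)]
  simp

theorem integrable_spectralMeasure {B : Matrix (Fin N) (Fin N) ℂ} (hN : N ≠ 0) (hB : B.IsHermitian)
    (f : ℝ → ℝ) : Integrable f (spectralMeasure hB) := by
  refine Integrable.smul_measure (integrable_finsetSum_measure.2 fun k _ =>
    integrable_dirac (by finiteness)) ?_
  simpa using hN

theorem empiricalSpectralDistribution_nonneg {B : Matrix (Fin N) (Fin N) ℂ} (hB : B.IsHermitian)
    (t : ℝ) : 0 ≤ empiricalSpectralDistribution hB t :=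
  mul_nonneg (by positivity) (Finset.sum_nonneg fun _ _ =>
    Set.indicator_nonneg (fun _ _ => zero_le_one) _)

theorem empiricalSpectralDistribution_le_one {B : Matrix (Fin N) (Fin N) ℂ} (hB : B.IsHermitian)
    (t : ℝ) : empiricalSpectralDistribution hB t ≤ 1 := by
  unfold empiricalSpectralDistribution
  have h : ∑ k, Set.indicator {s : ℝ | s ≤ t} (fun _ => (1 : ℝ)) (hB.eigenvalues k) ≤
      ∑ _k : Fin N, (1 : ℝ) :=
    Finset.sum_le_sum fun k _ => Set.indicator_le_self' (fun _ _ => zero_le_one) _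
  rw [Finset.sum_const, Finset.card_univ, Fintype.card_fin, nsmul_eq_mul, mul_one] at h
  calc _ ≤ (N : ℝ)⁻¹ * N := by gcongr
    _ ≤ 1 := inv_mul_le_one

/-- The expected spectral measure of a random Hermitian matrix. -/
theorem exists_expected_spectralMeasure {P : Measure Ω} [IsProbabilityMeasure P] (hN : N ≠ 0)
    (hA : ∀ ω, (A ω).IsHermitian) (hm : ∀ i j, Measurable fun ω => A ω i j)
    (hint : ∀ p : ℕ, Integrable (fun ω => (A ω ^ p).trace) P) :
    ∃ μ : Measure ℝ, IsProbabilityMeasure μ ∧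
      (∀ t, μ.real (Set.Iic t) = ∫ ω, empiricalSpectralDistribution (hA ω) t ∂P) ∧
      ∀ p : ℕ, Integrable (fun x => x ^ p) μ ∧
        ∫ x, x ^ p ∂μ = (N : ℝ)⁻¹ * ∫ ω, (A ω ^ p).trace.re ∂P := by
  have hprob : ∀ ω, IsProbabilityMeasure (spectralMeasure (hA ω)) := fun ω =>
    isProbabilityMeasure_spectralMeasure hN (hA ω)
  have hκ : Measurable fun ω => spectralMeasure (hA ω) := by
    refine Measurable.measure_of_isPiSystem_of_isProbabilityMeasure
      (borel_eq_generateFrom_Iic ℝ ▸ BorelSpace.measurable_eq) isPiSystem_Iic ?_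
    rintro _ ⟨t, rfl⟩
    simp only [spectralMeasure_Iic hN]
    exact (measurable_empiricalSpectralDistribution hA hm t).ennreal_ofReal
  let κ : Kernel Ω ℝ := ⟨fun ω => spectralMeasure (hA ω), hκ⟩
  have hκm : IsMarkovKernel κ := ⟨hprob⟩
  have hκa : ∀ ω, κ ω = spectralMeasure (hA ω) := fun ω => rfl
  have hpow : ∀ p : ℕ, Integrable (fun x : ℝ => x ^ p) (P.bind κ) := by
    intro p
    have hc : AEStronglyMeasurable (fun x : ℝ => x ^ p) (P.bind κ) :=
      (by fun_prop : Continuous fun x : ℝ => x ^ p).aestronglyMeasurable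
    rw [Measure.integrable_comp_iff hc]
    refine ⟨Eventually.of_forall fun ω => integrable_spectralMeasure hN (hA ω) _, ?_⟩
    simp only [hκa, integral_spectralMeasure]
    -- The inequality `|z| ≤ 1 + z ^ 2` with `z` the `p`-th power of an eigenvalue bounds absolute
    -- moments by a trace of an even power.
    have hdom : Integrable (fun ω => (N : ℝ)⁻¹ * ((N : ℝ) + (A ω ^ (2 * p)).trace.re)) P :=
      ((integrable_const _).add (hint (2 * p)).re).const_mul _
    refine hdom.mono' ?_ (Eventually.of_forall fun ω => ?_)
    · exact ((measurable_sum_eigenvalues_continuous hA hm (f := fun x => ‖x ^ p‖)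
        (by fun_prop)).const_mul _).aestronglyMeasurable
    · rw [← sum_eigenvalues_pow (hA ω), Real.norm_of_nonneg (by positivity)]
      gcongr
      have hsum : ∑ k, ((1 : ℝ) + (hA ω).eigenvalues k ^ (2 * p)) =
          N + ∑ k, (hA ω).eigenvalues k ^ (2 * p) := by
        rw [Finset.sum_add_distrib]
        simp
      rw [← hsum]
      refine Finset.sum_le_sum fun k _ => ?_
      rw [mul_comm 2 p, pow_mul, Real.norm_eq_abs]
      set z := (hA ω).eigenvalues k ^ p
      nlinarith [sq_nonneg (|z| - 1), sq_abs z, sq_nonneg z]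
  refine ⟨P.bind κ, inferInstance, fun t => ?_, fun p => ⟨hpow p, ?_⟩⟩
  · rw [measureReal_def, Measure.bind_apply measurableSet_Iic κ.aemeasurable,
      integral_eq_lintegral_of_nonneg_ae
        (Eventually.of_forall fun ω => empiricalSpectralDistribution_nonneg (hA ω) t)
        (measurable_empiricalSpectralDistribution hA hm t).aestronglyMeasurable]
    simp only [hκa, spectralMeasure_Iic hN]
  · have h := hpow p
    rw [Measure.comp_eq_comp_const_apply] at h ⊢
    rw [Kernel.integral_comp h, Kernel.const_apply]
    simp only [hκa, integral_spectralMeasure, sum_eigenvalues_pow]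
    rw [integral_const_mul]

end SpectralMeasure

/-! ### Truncation of the random matrices and the limit theorem -/

section LimitTheorem

/-- Diagonal choice: `K` grows so slowly that the `K N`-th sequence is already within `1/(K N + 1)`
of its limit at `N`. It lets the truncation level tend to zero with `N`. -/
theorem exists_tendsto_diagonal (g : ℕ → ℕ → ℝ) (hg : ∀ k, Tendsto (g k) atTop (𝓝 0)) :
    ∃ K : ℕ → ℕ, Tendsto K atTop atTop ∧ Tendsto (fun N => g (K N) N) atTop (𝓝 0) := by
  have h : ∀ k : ℕ, ∃ M, ∀ N ≥ M, |g k N| < 1 / ((k : ℝ) + 1) := fun k => by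
    have := Metric.tendsto_atTop.1 (hg k) (1 / ((k : ℝ) + 1)) (by positivity)
    simpa [Real.dist_eq] using this
  choose M hM using h
  let K : ℕ → ℕ := fun N => Nat.findGreatest (fun k => M k ≤ N) N
  have hK : Tendsto K atTop atTop := by
    rw [tendsto_atTop_atTop]
    exact fun k => ⟨max k (M k), fun N hN => Nat.le_findGreatest
      ((le_max_left _ _).trans hN) ((le_max_right _ _).trans hN)⟩
  refine ⟨K, hK, ?_⟩
  have h0 : Tendsto (fun N => 1 / ((K N : ℝ) + 1)) atTop (𝓝 0) :=
    tendsto_one_div_add_atTop_nhds_zero_nat.comp hK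
  refine squeeze_zero_norm' ?_ h0
  -- Below `M 0` the value `0` of `Nat.findGreatest` may be a mere default.
  filter_upwards [eventually_ge_atTop (M 0)] with N hN
  exact (hM (K N) N (Nat.findGreatest_spec (P := fun k => M k ≤ N) (Nat.zero_le N) hN)).le

/-- The normalised truncated entries. -/
noncomputable def truncatedEntry {Ω : Type*} {N : ℕ} (α : ℝ) (x : Fin N → Fin N → Ω → ℂ)
    (i j : Fin N) (ω : Ω) : ℂ :=
  (((Real.sqrt N)⁻¹ : ℝ) : ℂ) * truncate (α * Real.sqrt N) (x i j ω)

theorem norm_truncatedEntry_le {Ω : Type*} {N : ℕ} {x : Fin N → Fin N → Ω → ℂ} {α : ℝ}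
    (hα : 0 ≤ α) (hN : N ≠ 0) (i j : Fin N) (ω : Ω) :
    ‖truncatedEntry α x i j ω‖ ≤ α := by
  have hs : 0 < Real.sqrt N := by positivity
  rw [truncatedEntry, norm_mul, Complex.norm_real, Real.norm_of_nonneg (by positivity)]
  calc _ ≤ (Real.sqrt N)⁻¹ * (α * Real.sqrt N) := by
        gcongr
        exact norm_truncate_le (by positivity) _
    _ = α := by field_simp

variable {Ω : Type*} [MeasurableSpace Ω] {P : Measure Ω} {N : ℕ} {x : Fin N → Fin N → Ω → ℂ}

theorem iIndepFun_truncatedEntry (hind : iIndepFun (fun ij : Fin N × Fin N => x ij.1 ij.2) P)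
    (α : ℝ) : iIndepFun (fun ij : Fin N × Fin N => truncatedEntry α x ij.1 ij.2) P :=
  hind.comp (fun _ z => (((Real.sqrt N)⁻¹ : ℝ) : ℂ) * truncate (α * Real.sqrt N) z)
    fun _ => (measurable_truncate _).const_mul _

variable [IsProbabilityMeasure P]

theorem measurable_normalizedMatrix (hm : ∀ i j, Measurable (x i j)) (i j : Fin N) :
    Measurable fun ω => normalizedMatrix x ω i j := by
  simp only [normalizedMatrix, Matrix.of_apply]
  exact (hm i j).const_mul _

theorem measurable_powerMatrix (m : ℕ) (hm : ∀ i j, Measurable (x i j)) (i j : Fin N) :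
    Measurable fun ω => powerMatrix m (normalizedMatrix x ω) i j := by
  unfold powerMatrix
  refine measurable_matrix_mul (measurable_matrix_pow (measurable_normalizedMatrix hm) m)
    (measurable_matrix_pow (fun i j => ?_) m) i j
  simp only [Matrix.conjTranspose_apply]
  exact continuous_star.measurable.comp (measurable_normalizedMatrix hm j i)

theorem empiricalSpectralDistribution_congr {A B : Matrix (Fin N) (Fin N) ℂ} (hA : A.IsHermitian)
    (hB : B.IsHermitian) (h : A = B) (t : ℝ) :
    empiricalSpectralDistribution hA t = empiricalSpectralDistribution hB t := by
  subst h
  rfl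

theorem integrable_empiricalSpectralDistribution {A : Ω → Matrix (Fin N) (Fin N) ℂ}
    (hA : ∀ ω, (A ω).IsHermitian) (hm : ∀ i j, Measurable fun ω => A ω i j) (t : ℝ) :
    Integrable (fun ω => empiricalSpectralDistribution (hA ω) t) P := by
  refine Integrable.of_bound (C := 1)
    (measurable_empiricalSpectralDistribution hA hm t).aestronglyMeasurable
    (Eventually.of_forall fun ω => ?_)
  rw [Real.norm_of_nonneg (empiricalSpectralDistribution_nonneg _ t)]
  exact empiricalSpectralDistribution_le_one _ t

/-- Truncation alters the matrix only if some entry exceeds `α √N`. Two distribution functions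
differ by at most `1`, and then the Lindeberg sum divided by `(α √N)^4` is at least `1`: a pointwise
Markov bound and union bound. -/
theorem abs_expectedESD_sub_truncate_le (hm : ∀ i j, Measurable (x i j))
    (hint : ∀ i j, Integrable (fun ω => ‖x i j ω‖ ^ 4) P) (hN : N ≠ 0) {α : ℝ} (hα : 0 < α)
    (m : ℕ) (t : ℝ) :
    |expectedESD P x m t -
        expectedESD P (fun i j ω => truncate (α * Real.sqrt N) (x i j ω)) m t| ≤
      lindebergFourth P x α / α ^ 4 := by
  have hN' : (0 : ℝ) < N := by positivity
  set c := α * Real.sqrt N with hc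
  have hc0 : 0 < c := by positivity
  have hmt : ∀ i j, Measurable fun ω => truncate c (x i j ω) := fun i j =>
    (measurable_truncate c).comp (hm i j)
  have hind : ∀ i j, Integrable (fun ω =>
      Set.indicator {ω' | c < ‖x i j ω'‖} (fun ω' => ‖x i j ω'‖ ^ 4) ω) P := fun i j =>
    (hint i j).indicator (measurableSet_lt measurable_const (hm i j).norm)
  have hnn : ∀ i j ω, 0 ≤ Set.indicator {ω' | c < ‖x i j ω'‖} (fun ω' => ‖x i j ω'‖ ^ 4) ω :=
    fun i j ω => Set.indicator_nonneg (fun _ _ => by positivity) _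
  have hR : ∫ ω, (c ^ 4)⁻¹ * ∑ i, ∑ j,
      Set.indicator {ω' | c < ‖x i j ω'‖} (fun ω' => ‖x i j ω'‖ ^ 4) ω ∂P =
      lindebergFourth P x α / α ^ 4 := by
    rw [integral_const_mul, integral_finsetSum _ fun i _ => integrable_finsetSum _ fun j _ =>
      hind i j]
    simp_rw [fun i => integral_finsetSum (μ := P) Finset.univ fun j _ => hind i j]
    have h4 : c ^ 4 = α ^ 4 * (N : ℝ) ^ 2 := by
      rw [hc, mul_pow, show Real.sqrt N ^ 4 = (Real.sqrt N ^ 2) ^ 2 by ring,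
        Real.sq_sqrt hN'.le]
    rw [lindebergFourth, h4, mul_inv]
    ring
  rw [← hR, expectedESD, expectedESD, ← integral_sub
    (integrable_empiricalSpectralDistribution _ (measurable_powerMatrix m hm) t)
    (integrable_empiricalSpectralDistribution _ (measurable_powerMatrix m hmt) t)]
  have hRint : Integrable (fun ω => (c ^ 4)⁻¹ * ∑ i, ∑ j,
      Set.indicator {ω' | c < ‖x i j ω'‖} (fun ω' => ‖x i j ω'‖ ^ 4) ω) P :=
    (integrable_finsetSum _ fun i _ => integrable_finsetSum _ fun j _ => hind i j).const_mul _
  rw [← Real.norm_eq_abs]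
  refine norm_integral_le_of_norm_le hRint (Eventually.of_forall fun ω => ?_)
  by_cases hω : ∀ i j, ‖x i j ω‖ ≤ c
  · have heq : normalizedMatrix x ω =
        normalizedMatrix (fun i j ω => truncate c (x i j ω)) ω := by
      ext i j
      simp [normalizedMatrix, truncate, hω i j]
    rw [empiricalSpectralDistribution_congr _
      (powerMatrix_isHermitian m (normalizedMatrix (fun i j ω => truncate c (x i j ω)) ω))
      (by rw [heq]) t, sub_self, norm_zero]
    exact mul_nonneg (by positivity)
      (Finset.sum_nonneg fun i _ => Finset.sum_nonneg fun j _ => hnn i j ω)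
  · push Not at hω
    obtain ⟨i, j, hij⟩ := hω
    have h1 : c ^ 4 ≤ Set.indicator {ω' | c < ‖x i j ω'‖} (fun ω' => ‖x i j ω'‖ ^ 4) ω := by
      rw [Set.indicator_of_mem (by simpa using hij)]
      gcongr
    have h2 := h1.trans (Finset.single_le_sum (f := fun j =>
      Set.indicator {ω' | c < ‖x i j ω'‖} (fun ω' => ‖x i j ω'‖ ^ 4) ω)
      (fun j _ => hnn i j ω) (Finset.mem_univ j))
    have h3 := h2.trans (Finset.single_le_sum (f := fun i => ∑ j,
      Set.indicator {ω' | c < ‖x i j ω'‖} (fun ω' => ‖x i j ω'‖ ^ 4) ω)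
      (fun i _ => Finset.sum_nonneg fun j _ => hnn i j ω) (Finset.mem_univ i))
    have hle1 : ∀ {A B : Matrix (Fin N) (Fin N) ℂ} (hA : A.IsHermitian) (hB : B.IsHermitian),
        ‖empiricalSpectralDistribution hA t - empiricalSpectralDistribution hB t‖ ≤ 1 := by
      intro A B hA hB
      rw [Real.norm_eq_abs, abs_le]
      constructor <;> linarith [empiricalSpectralDistribution_nonneg hA t,
        empiricalSpectralDistribution_nonneg hB t, empiricalSpectralDistribution_le_one hA t,
        empiricalSpectralDistribution_le_one hB t]
    refine (hle1 _ _).trans ?_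
    rw [← div_eq_inv_mul, le_div_iff₀ (by positivity), one_mul]
    exact h3

theorem measurable_truncatedEntry (α : ℝ) (hm : ∀ i j, Measurable (x i j)) (i j : Fin N) :
    Measurable (truncatedEntry α x i j) :=
  ((measurable_truncate _).comp (hm i j)).const_mul _

theorem isMomentTable_truncatedEntry (hm : ∀ i j, Measurable (x i j))
    (hmean : ∀ i j, ∫ ω, x i j ω ∂P = 0) (hvar : ∀ i j, ∫ ω, ‖x i j ω‖ ^ 2 ∂P = 1) {B : ℝ}
    (hB : ∀ i j, Integrable (fun ω => ‖x i j ω‖ ^ 4) P ∧ ∫ ω, ‖x i j ω‖ ^ 4 ∂P ≤ B) (hN : N ≠ 0)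
    {α : ℝ} (hα : 0 < α) (hα1 : α ≤ 1) :
    IsMomentTable (N : ℝ)⁻¹ (α + (N : ℝ)⁻¹ * B / α ^ 3)
      (entryMoment P (truncatedEntry α x)) := by
  have hs : 0 < (Real.sqrt N)⁻¹ := by positivity
  have hρ : (Real.sqrt N)⁻¹ ^ 2 = (N : ℝ)⁻¹ := by
    rw [inv_pow, Real.sq_sqrt (Nat.cast_nonneg N)]
  have h := fun (e : Fin N × Fin N) (a b : ℕ) => moments_truncate (hm e.1 e.2) (hmean e.1 e.2)
    (hvar e.1 e.2) (hB e.1 e.2).1 (hB e.1 e.2).2 hs hα hα1 a b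
  simp only [hρ, inv_inv] at h
  exact ⟨fun e => by simp [entryMoment], fun e a b => (h e a b).1, fun e a b => (h e a b).2.1,
    fun e => (h e 1 1).2.2⟩

theorem abs_expected_trace_sub_le (hm : ∀ i j, Measurable (x i j))
    (hind : iIndepFun (fun ij : Fin N × Fin N => x ij.1 ij.2) P)
    (hmean : ∀ i j, ∫ ω, x i j ω ∂P = 0) (hvar : ∀ i j, ∫ ω, ‖x i j ω‖ ^ 2 ∂P = 1) {B : ℝ}
    (hB : ∀ i j, Integrable (fun ω => ‖x i j ω‖ ^ 4) P ∧ ∫ ω, ‖x i j ω‖ ^ 4 ∂P ≤ B) (hN : N ≠ 0)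
    {α : ℝ} (hα : 0 < α) (hα1 : α ≤ 1) (hB0 : 0 ≤ B) (hθ1 : α + (N : ℝ)⁻¹ * B / α ^ 3 ≤ 1)
    (w : List Bool) :
    |(N : ℝ)⁻¹ * ∫ ω, (wordMatrix (Matrix.of fun i j => truncatedEntry α x i j ω) w).trace.re ∂P -
        stackWeight (N : ℝ)⁻¹ w 1 []| ≤
      (w.length + 1) * (α + (N : ℝ)⁻¹ * B / α ^ 3 + (N : ℝ)⁻¹) * walkBound w.length 1 := by
  have hN' : (0 : ℝ) < N := by positivity
  have hm' := measurable_truncatedEntry α hm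
  have hM := norm_truncatedEntry_le (x := x) hα.le hN
  have h := norm_sum_pathMoment_sub_le (isMomentTable_truncatedEntry hm hmean hvar hB hN hα hα1)
    (by rw [Fintype.card_fin, mul_inv_cancel₀ hN'.ne']) (by positivity)
    (by rw [inv_le_one₀ hN']; exact_mod_cast Nat.one_le_iff_ne_zero.2 hN) (by positivity) hθ1 w
  rw [← integral_trace_wordMatrix hm' (iIndepFun_truncatedEntry hind α) hM] at h
  have hre : ∫ ω, (wordMatrix (Matrix.of fun i j => truncatedEntry α x i j ω) w).trace.re ∂P =
      (∫ ω, (wordMatrix (Matrix.of fun i j => truncatedEntry α x i j ω) w).trace ∂P).re :=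
    integral_re (integrable_trace_wordMatrix hm' hM w)
  rw [hre]
  refine le_trans ?_ h
  refine le_trans (le_of_eq ?_) (Complex.abs_re_le_norm _)
  rw [Complex.sub_re, Complex.re_ofReal_mul, Complex.ofReal_re]

end LimitTheorem

theorem tendsto_expectedESD {m : ℕ} (hm : 1 ≤ m) {ν : Measure ℝ} [IsProbabilityMeasure ν] {C : ℝ}
    (hC : 0 < C) (hsupp : ∀ᵐ s ∂ν, s ∈ Set.Icc 0 C) (hat : ∀ t, ν {t} = 0)
    (hmom : ∀ p : ℕ, ∫ s, s ^ p ∂ν =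
      1 / ((m : ℝ) * (p : ℝ) + 1) * (Nat.choose (m * p + p) p : ℝ))
    {Ω : ℕ → Type*} [∀ N, MeasurableSpace (Ω N)] {P : ∀ N, Measure (Ω N)}
    [∀ N, IsProbabilityMeasure (P N)] {x : ∀ N, Fin N → Fin N → Ω N → ℂ}
    (hx : EntryConditions P x) (t : ℝ) :
    Tendsto (fun N => expectedESD (P N) (x N) m t) atTop (𝓝 (ν.real (Set.Iic t))) := by
  obtain ⟨B, hB⟩ := hx.fourth
  -- The matrix size `N = 1` supplies an entry from which the sign of `B` is read off.
  have hB0 : 0 ≤ B := (integral_nonneg fun ω => by positivity).trans (hB 1 0 0).2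
  have hinv : Tendsto (fun N : ℕ => (N : ℝ)⁻¹) atTop (𝓝 0) := tendsto_inv_atTop_nhds_zero_nat
  -- Both the truncation cost and the bias term of the moment table must vanish along one sequence
  -- of levels; their absolute values are added so that one diagonal choice serves both.
  obtain ⟨K, hK, hKg⟩ := exists_tendsto_diagonal
    (fun k N => |lindebergFourth (P N) (x N) (1 / ((k : ℝ) + 1)) / (1 / ((k : ℝ) + 1)) ^ 4| +
      |(N : ℝ)⁻¹ * B / (1 / ((k : ℝ) + 1)) ^ 3|) fun k => by
    have h1 := ((hx.lindeberg (1 / ((k : ℝ) + 1)) (by positivity)).div_const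
      ((1 / ((k : ℝ) + 1)) ^ 4)).abs
    have h2 := ((hinv.mul_const B).div_const ((1 / ((k : ℝ) + 1)) ^ 3)).abs
    simpa using h1.add h2
  set α : ℕ → ℝ := fun N => 1 / ((K N : ℝ) + 1) with hα
  have hα0 : ∀ N, 0 < α N := fun N => by positivity
  have hα1 : ∀ N, α N ≤ 1 := fun N => by
    rw [hα]
    exact (div_le_one (by positivity)).2 (by linarith [(Nat.cast_nonneg (K N) : (0 : ℝ) ≤ K N)])
  have hαlim : Tendsto α atTop (𝓝 0) := tendsto_one_div_add_atTop_nhds_zero_nat.comp hK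
  have hLlim : Tendsto (fun N => lindebergFourth (P N) (x N) (α N) / α N ^ 4) atTop (𝓝 0) :=
    squeeze_zero_norm (fun N => by
      rw [Real.norm_eq_abs]
      exact le_add_of_nonneg_right (abs_nonneg _)) hKg
  have hBlim : Tendsto (fun N : ℕ => (N : ℝ)⁻¹ * B / α N ^ 3) atTop (𝓝 0) :=
    squeeze_zero_norm (fun N => by
      rw [Real.norm_eq_abs]
      exact le_add_of_nonneg_left (abs_nonneg _)) hKg
  have hθlim : Tendsto (fun N : ℕ => α N + (N : ℝ)⁻¹ * B / α N ^ 3) atTop (𝓝 0) := by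
    simpa using hαlim.add hBlim
  have hword : ∀ w : List Bool, Tendsto (fun N : ℕ => (N : ℝ)⁻¹ * ∫ ω, (wordMatrix
      (Matrix.of fun i j => truncatedEntry (α N) (x N) i j ω) w).trace.re ∂P N) atTop
      (𝓝 (stackCount w [])) := by
    intro w
    have h1 := tendsto_stackWeight hinv w 1 []
    have h2 : Tendsto (fun N : ℕ => ((w.length : ℝ) + 1) *
        (α N + (N : ℝ)⁻¹ * B / α N ^ 3 + (N : ℝ)⁻¹) * walkBound w.length 1) atTop (𝓝 0) := by
      simpa using ((hθlim.add hinv).const_mul ((w.length : ℝ) + 1)).mul_const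
        (walkBound w.length 1)
    have h3 := squeeze_zero_norm' (f := fun N : ℕ => (N : ℝ)⁻¹ * ∫ ω, (wordMatrix
      (Matrix.of fun i j => truncatedEntry (α N) (x N) i j ω) w).trace.re ∂P N -
        stackWeight (N : ℝ)⁻¹ w 1 []) (by
      filter_upwards [eventually_ne_atTop 0, hθlim.eventually_le_const zero_lt_one] with N hN hθ
      exact abs_expected_trace_sub_le (hx.measurable N) (hx.indep N) (hx.mean N)
        (hx.variance N) (hB N) hN (hα0 N) (hα1 N) hB0 hθ w) h2
    simpa using h3.add h1
  let y : ∀ N, Fin N → Fin N → Ω N → ℂ := fun N i j ω =>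
    truncate (α N * Real.sqrt N) (x N i j ω)
  have hym : ∀ N i j, Measurable (y N i j) := fun N i j =>
    (measurable_truncate _).comp (hx.measurable N i j)
  have hyword : ∀ N p ω, powerMatrix m (normalizedMatrix (y N) ω) ^ p =
      wordMatrix (Matrix.of fun i j => truncatedEntry (α N) (x N) i j ω) (blockWord m p) :=
    fun N p ω => powerMatrix_pow_eq m p _
  -- The shift to `n + 1` avoids the empty matrix, which has no spectral probability measure.
  have hexists := fun n : ℕ => exists_expected_spectralMeasure (P := P (n + 1)) n.succ_ne_zero
    (fun ω => powerMatrix_isHermitian m (normalizedMatrix (y (n + 1)) ω))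
    (measurable_powerMatrix m (hym (n + 1))) (fun p => by
      simp only [hyword]
      exact integrable_trace_wordMatrix (measurable_truncatedEntry _ (hx.measurable (n + 1)))
        (norm_truncatedEntry_le (hα0 (n + 1)).le n.succ_ne_zero) _)
  choose μ hμ hμIic hμmom using hexists
  have hlim : Tendsto (fun n => (μ n).real (Set.Iic t)) atTop (𝓝 (ν.real (Set.Iic t))) := by
    refine tendsto_measureReal_Iic_of_tendsto_moments hC hsupp hat (fun n p => (hμmom n p).1)
      (fun p => ?_) t
    rw [hmom, ← stackCount_blockWord_nil m p hm]
    have h := (tendsto_add_atTop_iff_nat 1).2 (hword (blockWord m p))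
    refine h.congr fun n => ?_
    rw [(hμmom n p).2]
    simp only [hyword]
  have htrunc : Tendsto (fun N => expectedESD (P N) (y N) m t) atTop (𝓝 (ν.real (Set.Iic t))) := by
    rw [← tendsto_add_atTop_iff_nat 1]
    exact hlim.congr fun n => hμIic n t
  have hdiff : Tendsto (fun N => expectedESD (P N) (x N) m t - expectedESD (P N) (y N) m t) atTop
      (𝓝 0) := by
    refine squeeze_zero_norm' ?_ hLlim
    filter_upwards [eventually_ne_atTop 0] with N hN
    exact abs_expectedESD_sub_truncate_le (hx.measurable N) (fun i j => (hB N i j).1) hN (hα0 N) m t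
  simpa using hdiff.add htrunc

/-- `G` is chosen before the probability spaces and the entries, which expresses that it depends
only on `m`; monotonicity and right-continuity are part of `StieltjesFunction`. -/
theorem theorem1 (m : ℕ) (hm : 1 ≤ m) :
    ∃ G : StieltjesFunction ℝ,
      (Tendsto G atBot (𝓝 0) ∧ Tendsto G atTop (𝓝 1)) ∧
      (∀ p : ℕ, Integrable (fun s : ℝ => s ^ p) G.measure ∧
        ∫ s : ℝ, s ^ p ∂G.measure =
          1 / ((m : ℝ) * (p : ℝ) + 1) * (Nat.choose (m * p + p) p : ℝ)) ∧
      ∀ (Ω : ℕ → Type*) [∀ N, MeasurableSpace (Ω N)] (P : ∀ N, Measure (Ω N))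
        [∀ N, IsProbabilityMeasure (P N)] (x : ∀ N, Fin N → Fin N → Ω N → ℂ),
        EntryConditions P x →
        ∀ t : ℝ, Tendsto (fun N => expectedESD (P N) (x N) m t) atTop (𝓝 (G t)) := by
  obtain ⟨ν, hν, ⟨C, hC, hsupp⟩, hat, hmom⟩ := exists_fussCatalan_law hm
  refine ⟨cdf ν, ⟨tendsto_cdf_atBot ν, tendsto_cdf_atTop ν⟩, fun p => ?_, ?_⟩
  · rw [measure_cdf]
    exact ⟨integrable_pow_of_ae_mem_Icc hsupp p, hmom p⟩
  · intro Ω _ P _ x hx t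
    rw [cdf_eq_real]
    exact tendsto_expectedESD hm hC hsupp hat hmom hx t
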